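/- **Setting.** Let $d\ge 2$, write instances as $x=(\tilde x,x_d)\in[0,1]^{d-1}\times[0,1]$, and let $g^*:[0,1]^{d-1}\to[0,1]$ (the true decision boundary; no smoothness of $g^*$ is needed for this result). A labeler, queried at $x$, answers $Y\in\{0,1,\perp\}$ with distribution $P(\cdot\mid x)$, independently for all queries. *Condition 1.* (a) If $|x_d-g^*(\tilde x)|\ge|x_d'-g^*(\tilde x)|$ then $P(\perp\mid(\tilde x,x_d))\le P(\perp\mid(\tilde x,x_d'))$. (b) $P(Y\ne\mathbf 1[x_d>g^*(\tilde x)]\mid x,Y\ne\perp)\le\frac12$ whenever $P(\perp\mid x)\neq1$. *Condition 2* (with constants $C>0$, $\beta\ge0$ and a nondecreasing $f:[0,1]\to[0,1]$). (a) $P(\perp\mid x)\le1-f(|x_d-g^*(\tilde x)|)$. (b) $P(Y\ne\mathbf 1[x_d>g^*(\tilde x)]\mid x,Y\ne\perp)\le\frac12\bigl(1-C|x_d-g^*(\tilde x)|^\beta\bigr)$ whenever $P(\perp\mid x)\neq1$. **Tests.** Let $[\ln\ln]_+(x)=\ln\ln\max\{x,e^e\}$, $p(n,\delta)=D_0\bigl(1+\ln\frac1\delta+\sqrt{4n([\ln\ln]_+(4n)+\ln\frac1\delta)}\bigr)$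 and $q(v,\delta)=D_1\bigl(1+\ln\frac1\delta+\sqrt{w([\ln\ln]_+(w)+\ln\frac1\delta)}\bigr)$ with $w=v+\ln\frac1\delta+1$; for an array $X_1,\dots,X_n$ let $V_n=\frac n{n-1}\bigl(\sum_iX_i^2-\frac1n(\sum_iX_i)^2\bigr)$ (and $0$ if $n\le1$). CheckSignificant$(\{X_i\}_{i\le n},\delta)$ is true iff $\sum_iX_i\ge p(n,\delta)$; CheckSignificant-Var$(\{X_i\}_{i\le n},\delta)$ is true iff $n\ge\ln\frac1\delta$ and $\sum_iX_i\ge q(V_n,\delta)$. Here $D_0,D_1$ are absolute constants such that for every i.i.d. sequence $X_1,X_2,\dots$ with values in $[-2,2]$ and mean $0$ and every $\delta\in(0,1)$: (i) with probability at least $1-\delta$, $|\sum_{i\le n}X_i|\le p(n,\delta)$ for all $n$; (ii) with probability at least $1-\delta$, $|\sum_{i\le n}X_i|\le q(V_n,\delta)$ for all $n\ge\ln\frac1\delta$. **Algorithm 1** (input $\epsilon,\delta$, with $N=\log_{4/3}\frac1{2\epsilon}$ a natural number; it queries points $t\in[0,1]$). Start with $[L_0,R_0]=[0,1]$ and put $\delta'=\delta/(4N)$.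 For $k=0,\dots,N-1$: let $U,M,V=\frac{3L_k+R_k}4,\frac{L_k+R_k}2,\frac{L_k+3R_k}4$; in rounds $n=1,2,\dots$ query $U,M,V$ once each. For $w\in\{U,M,V\}$ let $A^w_i=1$ if the $i$-th answer of this epoch at $w$ is not $\perp$ and $0$ otherwise, and let $B^w$ be the array of the non-abstaining answers at $w$ so far in this epoch, coded as $-1$ (label 0) and $+1$ (label 1). After each round, run in this order, with level $\delta'$, the tests CheckSignificant-Var on $\{A^U_i-A^M_i\}_{i\le n}$, CheckSignificant-Var on $\{A^V_i-A^M_i\}_{i\le n}$, CheckSignificant on $-B^U$, CheckSignificant on $B^V$; at the first success end the epoch with $[L_{k+1},R_{k+1}]$ equal to $[U,R_k]$, $[L_k,V]$, $[U,R_k]$, $[L_k,V]$ respectively. Output $(L_N+R_N)/2$. **Algorithm 2** (input $\epsilon,\delta$, an integer $\gamma\ge1$, and an integer $M$ divisible by $\gamma$ with $c_1\epsilon^{-1/\gamma}\le M\le c_2\epsilon^{-1/\gamma}$, where $c_1,c_2>0$). For each $l\in\{0,\frac1M,\dots,\frac{M-1}M\}^{d-1}$ run Algorithm 1 with input $(\epsilon,\delta/M^{d-1})$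 on the line $\{(l,t):t\in[0,1]\}$, obtaining a threshold $g_l$. For $q\in\{0,\dots,\frac M\gamma-1\}^{d-1}$ let $I_q=\prod_i[\frac{q_i\gamma}M,\frac{(q_i+1)\gamma}M]$, and output $$g(\tilde x)=\sum_q\mathbf 1[\tilde x\in I_q]\sum_{l\in I_q}g_l\prod_{i=1}^{d-1}\ \prod_{0\le j\le\gamma,\ j\ne Ml_i-\gamma q_i}\frac{\tilde x_i-(\gamma q_i+j)/M}{l_i-(\gamma q_i+j)/M}.$$ **Theorem.** Constants $D_0$ with (i) and $D_1$ with (ii) exist. There is an absolute exponent $p\in\mathbb N$ such that for all such $D_0,D_1$ and all $C>0$, $\beta\ge0$, $c_2>0$ there is a constant $K>0$, depending only on $D_0,D_1,C,\beta,c_2$, with the following property. Let $d\ge2$, let $\gamma\ge1$ and $M$ be integers, let $c_1>0$, let $\epsilon>0$ with $\log_{4/3}\frac1{2\epsilon}\in\mathbb N$, let $\gamma\mid M$ and $c_1\epsilon^{-1/\gamma}\le M\le c_2\epsilon^{-1/\gamma}$, let $0<\delta<1$, let $f:[0,1]\to[0,1]$ be nondecreasing with $f(\epsilon/2)>0$,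 and let $g^*:[0,1]^{d-1}\to[0,1]$. If the labeler satisfies Conditions 1 and 2 (with $C,\beta,f$), then with probability at least $1-\delta$ Algorithm 2 halts after at most $$K\,c_2^{\,d-1}\cdot\frac{d}{f(\epsilon/2)}\,\epsilon^{-2\beta-\frac{d-1}\gamma}\cdot\Bigl[\bigl(1+\ln\tfrac1\epsilon\bigr)\bigl(1+\ln\tfrac1\delta\bigr)\bigl(1+\ln d\bigr)\Bigr]^p$$ queries; that is, it makes at most $\tilde O\bigl(\frac{d}{f(\epsilon/2)}\epsilon^{-2\beta-\frac{d-1}\gamma}\bigr)$ queries, where $\tilde O$ hides factors logarithmic in $\frac1\epsilon,\frac1\delta,d$. -/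

import Mathlib

open MeasureTheory ProbabilityTheory

noncomputable section

namespace AbstentionLearning

/-! ### The labeler and its conditions -/

/-- The possible answers of the labeler: the labels `0`, `1`, or abstention. -/
inductive Response : Type where
  | zero : Response
  | one : Response
  | abstain : Response

instance : MeasurableSpace Response := ⊤

instance : DiscreteMeasurableSpace Response := ⟨fun _ => trivial⟩

/-- Instances `x = (x̃, x_d)`, where `x̃` has `m = d - 1` coordinates. -/
abbrev Point (m : ℕ) : Type := (Fin m → ℝ) × ℝ

/-- A labeler: its response distribution at every instance. Only its values on the cube
`[0,1]^(m+1)` play a role. -/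
abbrev Labeler (m : ℕ) : Type := Point m → PMF Response

/-- The cube `[0,1]^m`. -/
def cube (m : ℕ) : Set (Fin m → ℝ) := Set.Icc 0 1

/-- `P(⊥ ∣ x)`. -/
def abstainProb {m : ℕ} (P : Labeler m) (x : Point m) : ℝ := (P x Response.abstain).toReal

open Classical in
/-- The label that differs from the ground truth `𝟙[x_d > g x̃]`. -/
def wrongLabel {m : ℕ} (g : (Fin m → ℝ) → ℝ) (x : Point m) : Response :=
  if g x.1 < x.2 then Response.zero else Response.one

/-- `P(Y ≠ 𝟙[x_d > g x̃] ∣ x, Y ≠ ⊥)`, meaningful if `P(⊥ ∣ x) ≠ 1`. -/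
def noiseProb {m : ℕ} (P : Labeler m) (g : (Fin m → ℝ) → ℝ) (x : Point m) : ℝ :=
  (P x (wrongLabel g x)).toReal / (1 - abstainProb P x)

/-- The first condition: abstention is more likely closer to the decision boundary, and a label
that is given is wrong with probability at most `1/2`. -/
structure MonotoneLabeler {m : ℕ} (P : Labeler m) (g : (Fin m → ℝ) → ℝ) : Prop where
  abstention : ∀ u ∈ cube m, ∀ s ∈ Set.Icc (0 : ℝ) 1, ∀ s' ∈ Set.Icc (0 : ℝ) 1,
    |s' - g u| ≤ |s - g u| → abstainProb P (u, s) ≤ abstainProb P (u, s')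
  noise : ∀ u ∈ cube m, ∀ s ∈ Set.Icc (0 : ℝ) 1, abstainProb P (u, s) ≠ 1 →
    noiseProb P g (u, s) ≤ 1 / 2

/-- The second condition, with parameters `C`, `β`, `f`. -/
structure BoundedLabeler {m : ℕ} (P : Labeler m) (g : (Fin m → ℝ) → ℝ)
    (C β : ℝ) (f : ℝ → ℝ) : Prop where
  abstention : ∀ u ∈ cube m, ∀ s ∈ Set.Icc (0 : ℝ) 1,
    abstainProb P (u, s) ≤ 1 - f |s - g u|
  noise : ∀ u ∈ cube m, ∀ s ∈ Set.Icc (0 : ℝ) 1, abstainProb P (u, s) ≠ 1 →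
    noiseProb P g (u, s) ≤ 1 / 2 * (1 - C * |s - g u| ^ β)

/-! ### Adaptive sequential testing -/

/-- `[ln ln]₊ x = ln ln max {x, e^e}`. -/
def lnlnPlus (x : ℝ) : ℝ := Real.log (Real.log (max x (Real.exp (Real.exp 1))))

/-- The threshold `p(n, δ)`, with constant `D₀`. -/
def thresholdP (D₀ : ℝ) (n : ℕ) (δ : ℝ) : ℝ :=
  D₀ * (1 + Real.log (1 / δ) + √(4 * n * (lnlnPlus (4 * n) + Real.log (1 / δ))))

/-- The threshold `q(n, v, δ)`, with constant `D₁`. -/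
def thresholdQ (D₁ : ℝ) (v δ : ℝ) : ℝ :=
  D₁ * (1 + Real.log (1 / δ) +
    √((v + Real.log (1 / δ) + 1) *
      (lnlnPlus (v + Real.log (1 / δ) + 1) + Real.log (1 / δ))))

/-- The empirical variance `n/(n-1) * (∑ Xᵢ² - (∑ Xᵢ)²/n)` of an array (`0` if `n ≤ 1`). -/
def empVar (S : List ℝ) : ℝ :=
  (S.length : ℝ) / ((S.length : ℝ) - 1) *
    ((S.map (fun x => x ^ 2)).sum - 1 / (S.length : ℝ) * S.sum ^ 2)

def CheckSignificant (D₀ : ℝ) (S : List ℝ) (δ : ℝ) : Prop :=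
  thresholdP D₀ S.length δ ≤ S.sum

def CheckSignificantVar (D₁ : ℝ) (S : List ℝ) (δ : ℝ) : Prop :=
  Real.log (1 / δ) ≤ S.length ∧ thresholdQ D₁ (empVar S) δ ≤ S.sum

/-- The array of the first `n` entries of a sequence. -/
def firstEntries (X : ℕ → ℝ) (n : ℕ) : List ℝ := (List.range n).map X

/-- `X` is an i.i.d. sequence of centered random variables with values in `[-2,2]`. -/
structure IsCenteredIID {Ω : Type} [MeasurableSpace Ω] (P : Measure Ω) (X : ℕ → Ω → ℝ) :
    Prop where
  measurable : ∀ i, Measurable (X i)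
  indep : iIndepFun X P
  ident : ∀ i, IdentDistrib (X i) (X 0) P P
  mem_Icc : ∀ i ω, X i ω ∈ Set.Icc (-2 : ℝ) 2
  mean : ∫ ω, X 0 ω ∂P = 0

/-- The property of the absolute constant `D₀` used by `CheckSignificant`: the uniform
concentration inequality for the empirical mean. -/
def UniformBernstein (D₀ : ℝ) : Prop :=
  ∀ (Ω : Type) [MeasurableSpace Ω] (P : Measure Ω) [IsProbabilityMeasure P]
    (X : ℕ → Ω → ℝ), IsCenteredIID P X → ∀ δ ∈ Set.Ioo (0 : ℝ) 1,
    ENNReal.ofReal (1 - δ) ≤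
      P {ω | ∀ n : ℕ, |(firstEntries (X · ω) n).sum| ≤ thresholdP D₀ n δ}

/-- The property of the absolute constant `D₁` used by `CheckSignificantVar`: the uniform
concentration inequality with the empirical variance. -/
def UniformEmpiricalBernstein (D₁ : ℝ) : Prop :=
  ∀ (Ω : Type) [MeasurableSpace Ω] (P : Measure Ω) [IsProbabilityMeasure P]
    (X : ℕ → Ω → ℝ), IsCenteredIID P X → ∀ δ ∈ Set.Ioo (0 : ℝ) 1,
    ENNReal.ofReal (1 - δ) ≤
      P {ω | ∀ n : ℕ, Real.log (1 / δ) ≤ n → |(firstEntries (X · ω) n).sum| ≤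
        thresholdQ D₁ (empVar (firstEntries (X · ω) n)) δ}

/-! ### The algorithm for thresholds -/

/-- The entry recorded in the array `A`: `0` for an abstention, `1` otherwise. -/
def Response.answered : Response → ℝ
  | .abstain => 0
  | _ => 1

/-- The entry recorded in the array `B`: `-1` for label 0, `1` for label 1, none for `⊥`. -/
def Response.sign? : Response → Option ℝ
  | .zero => some (-1)
  | .one => some 1
  | .abstain => none

/-- The array `B` after `n` rounds with responses `X`. -/
def signArray (X : ℕ → Response) (n : ℕ) : List ℝ :=
  (List.range n).filterMap fun i => (X i).sign?

open Classical in
/-- The tests of an epoch with current interval `[I.1, I.2]`, after its first `n` rounds: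
`resp i x` is the response in round `i` (counted from `0`) to a query at `x`, and `δ'` is the
confidence level of each test. The value is the new interval, if one of the tests succeeds. -/
def epochTest (D₀ D₁ δ' : ℝ) (resp : ℕ → ℝ → Response) (I : ℝ × ℝ) (n : ℕ) :
    Option (ℝ × ℝ) :=
  let U := (3 * I.1 + I.2) / 4
  let M := (I.1 + I.2) / 2
  let V := (I.1 + 3 * I.2) / 4
  let A : ℝ → ℕ → ℝ := fun x i => (resp i x).answered
  let B : ℝ → List ℝ := fun x => signArray (fun i => resp i x) n
  if CheckSignificantVar D₁ (firstEntries (fun i => A U i - A M i) n) δ' then some (U, I.2)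
  else if CheckSignificantVar D₁ (firstEntries (fun i => A V i - A M i) n) δ' then some (I.1, V)
  else if CheckSignificant D₀ ((B U).map fun b => -b) δ' then some (U, I.2)
  else if CheckSignificant D₀ (B V) δ' then some (I.1, V)
  else none

open Classical in
/-- One epoch: three queries in each round, until the first round `n = 1, 2, …` after which a test
succeeds. The value is the new interval and the number of queries made, or `none` if the epoch
never ends. -/
def runEpoch (D₀ D₁ δ' : ℝ) (resp : ℕ → ℝ → Response) (I : ℝ × ℝ) : Option ((ℝ × ℝ) × ℕ) :=
  if h : ∃ n : ℕ, 1 ≤ n ∧ (epochTest D₀ D₁ δ' resp I n).isSome then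
    (epochTest D₀ D₁ δ' resp I (Nat.find h)).map fun J => (J, 3 * Nat.find h)
  else none

/-- The first `k` epochs from `[0,1]`: the current interval and the number of queries so far;
`resp j i x` is the response in round `i` of epoch `j` to a query at `x`. -/
def runEpochs (D₀ D₁ δ' : ℝ) (resp : ℕ → ℕ → ℝ → Response) : ℕ → Option ((ℝ × ℝ) × ℕ)
  | 0 => some ((0, 1), 0)
  | k + 1 => (runEpochs D₀ D₁ δ' resp k).bind fun s =>
      (runEpoch D₀ D₁ δ' (resp k) s.1).map fun t => (t.1, s.2 + t.2)

/-- `log_{4/3} (1/(2ε))`, assumed to be a natural number where the algorithm is run. -/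
def epochLog (ε : ℝ) : ℝ := Real.logb (4 / 3) (1 / (2 * ε))

/-- The algorithm for thresholds with input `(ε, δ)`: the threshold that it outputs and the number
of queries made, or `none` if it never halts. -/
def thresholdAlg (D₀ D₁ ε δ : ℝ) (resp : ℕ → ℕ → ℝ → Response) : Option (ℝ × ℕ) :=
  (runEpochs D₀ D₁ (δ / (4 * epochLog ε)) resp ⌊epochLog ε⌋₊).map fun s =>
    ((s.1.1 + s.1.2) / 2, s.2)

/-! ### The algorithm for boundary fragments -/

/-- The point `a / M` of the lattice `{0, 1/M, …, (M-1)/M}^m`. -/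
def latticePoint {m : ℕ} (M : ℕ) (a : Fin m → Fin M) : Fin m → ℝ :=
  fun i => ((a i : ℕ) : ℝ) / M

/-- The cell `I_q`. -/
def cell {m : ℕ} (γ M : ℕ) (q : Fin m → Fin (M / γ)) : Set (Fin m → ℝ) :=
  {x | ∀ i, ((q i : ℕ) : ℝ) * γ / M ≤ x i ∧ x i ≤ (((q i : ℕ) : ℝ) + 1) * γ / M}

/-- The interpolation polynomial `Q_{q,l}` for the lattice point `l = a / M`. -/
def interpPoly {m : ℕ} (γ M : ℕ) (q : Fin m → Fin (M / γ)) (a : Fin m → Fin M)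
    (x : Fin m → ℝ) : ℝ :=
  ∏ i, ∏ j ∈ (Finset.range (γ + 1)).filter (fun j => γ * (q i : ℕ) + j ≠ (a i : ℕ)),
    (x i - ((γ * (q i : ℕ) + j : ℕ) : ℝ) / M) /
      (latticePoint M a i - ((γ * (q i : ℕ) + j : ℕ) : ℝ) / M)

open Classical in
/-- The boundary function interpolated from the thresholds `θ` at the lattice points. -/
def interpolate {m : ℕ} (γ M : ℕ) (θ : (Fin m → Fin M) → ℝ) (x : Fin m → ℝ) : ℝ :=
  ∑ q : Fin m → Fin (M / γ),
    (∑ a ∈ Finset.univ.filter (fun a : Fin m → Fin M => latticePoint M a ∈ cell γ M q),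
      θ a * interpPoly γ M q a x) * (cell γ M q).indicator 1 x

/-- Tables of responses: `ω (k, i, x)` is the response to a query at the instance `x` in round `i`
of epoch `k` (of the run of the threshold algorithm which queries on the line of `x`). No entry is
read twice, so that every query receives a fresh response. -/
abbrev ResponseTable (m : ℕ) : Type := ℕ × ℕ × Point m → Response

/-- The law of the responses of the labeler `P`: independent, and distributed as `P x` for every
query at `x`. -/
def responseLaw {m : ℕ} (P : Labeler m) : Measure (ResponseTable m) :=
  Measure.infinitePi fun i : ℕ × ℕ × Point m => (P i.2.2).toMeasure

open Classical in
/-- The algorithm for boundary fragments with input `(ε, δ, γ)` and grid parameter `M`: the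
boundary function that it outputs and the total number of queries made, or `none` if one of the
runs of the threshold algorithm never halts. -/
def boundaryAlg {m : ℕ} (D₀ D₁ ε δ : ℝ) (γ M : ℕ) (ω : ResponseTable m) :
    Option (((Fin m → ℝ) → ℝ) × ℕ) :=
  let run : (Fin m → Fin M) → Option (ℝ × ℕ) := fun a =>
    thresholdAlg D₀ D₁ ε (δ / (M : ℝ) ^ m) fun k i t => ω (k, i, (latticePoint M a, t))
  if ∀ a, (run a).isSome then
    some (interpolate γ M fun a => ((run a).getD (0, 0)).1, ∑ a, ((run a).getD (0, 0)).2)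
  else none

end AbstentionLearning

end

open AbstentionLearning

noncomputable section

namespace AbstentionLearning

/-! ### Ville's inequality and line crossing -/

section Ville

variable {Ω : Type*} [MeasurableSpace Ω] {P : Measure Ω} [IsProbabilityMeasure P]

/-! Existence of the constants. If X is centered with |X| ≤ 2 and variance at most v, then E exp(λX)
≤ exp(λ²v) for |λ| ≤ 1/2. Ville's inequality for the normalized products of exponentials keeps the
partial sums below a line of slope λv in n, for all n at once. Lines with geometrically decreasing
λ, at confidence levels δ/(2(k+1)(k+2)), are stitched into the iterated logarithm boundary
(`exists_scale_le`, `IsCenteredIID.measure_abs_le`). Taking v = 4 gives `UniformBernstein`. For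
`UniformEmpiricalBernstein` the true variance v is kept, the sum of squares is bounded below by the
same method (`IsCenteredIID.measure_sum_sq_le`), and n·v is then replaced by the empirical variance
(`exists_empirical_bound`).

One epoch. Let θ be the true threshold on a line, lying in the current interval with quartiles U, M,
V. Discarding the part left of U is an error only if θ < U. In that case U is nearer to θ than M, so
abstention at U is at least as likely as at M, and labels at U favour 1 or neither label. Both tests
that lead to this cut therefore see a nonpositive drift and fail at all rounds, up to probability δ'
each. The case θ > V is symmetric. For termination, one of U, V has distance at least ε/2 from θ, on
the informative side. There answers arrive at rate at least f(ε/2) and labels have bias at least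
C(ε/2)^β, so about ε^(-2β) answers, up to logarithms, make the label test succeed; a Chernoff bound
converts answers into rounds at the cost of a factor 1/f(ε/2). Altogether an epoch fails with
probability at most 4δ' (`epochLaw_not_epochGood_le`).

Two probabilistic points need care. The label test reads only the answers that are not abstentions;
an answer is realized as an independent pair of an abstention decision and a label, and for a fixed
abstention pattern the labels read are i.i.d. (`UniformBernstein.measure_answers_le`). The interval
at the start of an epoch is random, but it takes finitely many values and depends only on earlier
epochs, hence is independent of the responses of the current one (`responseLaw_not_runGood_le`).

Union bounds over N epochs and M^(d-1) lines give confidence 1 - δ, and the number of queries is at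
most M^(d-1)·3TN with T rounds per epoch. The factor d comes from the logarithm of the level
δ/(4N·M^(d-1)). The interpolation step makes no queries and plays no role. -/

/-- Partial products of independent nonnegative random variables of mean one form a martingale. -/
theorem martingale_prod_of_iIndepFun {Z : ℕ → Ω → ℝ} (hZm : ∀ i, Measurable (Z i))
    (hZi : iIndepFun Z P) (hint : ∀ i, Integrable (Z i) P) (hmean : ∀ i, ∫ ω, Z i ω ∂P = 1) :
    Martingale (fun n ω => ∏ i ∈ Finset.range (n + 1), Z i ω)
      (Filtration.natural Z fun i => (hZm i).stronglyMeasurable) P := by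
  set ℱ := Filtration.natural Z fun i => (hZm i).stronglyMeasurable
  have hadp : StronglyAdapted ℱ (fun n ω => ∏ i ∈ Finset.range (n + 1), Z i ω) := by
    intro n
    have : ∀ i ∈ Finset.range (n + 1), StronglyMeasurable[ℱ n] (Z i) := fun i hi =>
      (Filtration.stronglyAdapted_natural (fun i => (hZm i).stronglyMeasurable) i).mono
        (ℱ.mono (Finset.mem_range_succ_iff.1 hi))
    exact Finset.stronglyMeasurable_fun_prod _ this
  have hI : ∀ n, Integrable (fun ω => ∏ i ∈ Finset.range (n + 1), Z i ω) P := by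
    intro n
    induction n with
    | zero => simpa using hint 0
    | succ n ih =>
      simp_rw [Finset.prod_range_succ _ (n + 1)]
      have hind := hZi.indepFun_finsetProd_of_notMem hZm
        (s := Finset.range (n + 1)) (i := n + 1) (by simp)
      have := hind.integrable_mul (by convert ih using 2; simp) (hint (n + 1))
      convert this using 2
      simp
  refine martingale_nat hadp hI fun n => ?_
  have h1 : (fun ω => ∏ i ∈ Finset.range (n + 1 + 1), Z i ω)
      = (fun ω => ∏ i ∈ Finset.range (n + 1), Z i ω) * Z (n + 1) := by
    ext ω; simp [Finset.prod_range_succ _ (n + 1)]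
  have h2 := condExp_mul_of_stronglyMeasurable_left (μ := P) (m := ℱ n) (hadp n)
    (by rw [← h1]; exact hI (n + 1)) (hint (n + 1))
  have h3 := hZi.condExp_natural_ae_eq_of_lt (fun i => (hZm i).stronglyMeasurable)
    (Nat.lt_succ_self n)
  rw [h1]
  filter_upwards [h2, h3] with ω hω hω'
  rw [hω, Pi.mul_apply, hω', hmean, mul_one]

/-- Ville's inequality for products of independent nonnegative random variables of mean one. -/
theorem measure_exists_le_prod_le {Z : ℕ → Ω → ℝ} (hZm : ∀ i, Measurable (Z i))
    (hZi : iIndepFun Z P) (hint : ∀ i, Integrable (Z i) P) (hmean : ∀ i, ∫ ω, Z i ω ∂P = 1)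
    (hpos : ∀ i ω, 0 ≤ Z i ω) {c : ℝ} (hc : 1 < c) :
    P {ω | ∃ n, c ≤ ∏ i ∈ Finset.range n, Z i ω} ≤ ENNReal.ofReal (1 / c) := by
  have hmart := martingale_prod_of_iIndepFun hZm hZi hint hmean
  set M : ℕ → Ω → ℝ := fun n ω => ∏ i ∈ Finset.range (n + 1), Z i ω with hM
  have hM0 : 0 ≤ M := fun n ω => Finset.prod_nonneg fun i _ => hpos i ω
  have hEM : ∀ n, ∫ ω, M n ω ∂P = 1 := by
    intro n
    have h := hmart.setIntegral_eq (Nat.zero_le n) MeasurableSet.univ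
    simp only [setIntegral_univ] at h
    rw [← h]
    simpa [hM] using hmean 0
  have hc0 : 0 < c := by linarith
  have hfin : ∀ n, P {ω | ∃ k ≤ n, c ≤ M k ω} ≤ ENNReal.ofReal (1 / c) := by
    intro n
    have h := maximal_ineq hmart.submartingale hM0 (ε := c.toNNReal) n
    have hset : {ω | (c.toNNReal : ℝ) ≤
        (Finset.range (n + 1)).sup' Finset.nonempty_range_add_one fun k => M k ω}
        = {ω | ∃ k ≤ n, c ≤ M k ω} := by
      ext ω
      simp [Finset.le_sup'_iff, hc0.le]
    rw [hset] at h
    have h2 : ∫ ω in {ω | ∃ k ≤ n, c ≤ M k ω}, M n ω ∂P ≤ 1 := by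
      rw [← hEM n]
      exact setIntegral_le_integral (hmart.integrable n) (Filter.Eventually.of_forall (hM0 n))
    have h3 : (c.toNNReal : ENNReal) * P {ω | ∃ k ≤ n, c ≤ M k ω} ≤ 1 :=
      h.trans (by simpa using ENNReal.ofReal_le_ofReal h2)
    rw [one_div, ENNReal.ofReal_inv_of_pos hc0, ENNReal.le_inv_iff_mul_le, mul_comm]
    exact h3
  have hU : {ω | ∃ n, c ≤ ∏ i ∈ Finset.range n, Z i ω} ⊆ ⋃ n, {ω | ∃ k ≤ n, c ≤ M k ω} := by
    rintro ω ⟨n, hn⟩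
    -- The empty product equals 1 < c; this index is not covered by the martingale, which starts
    -- with one factor.
    cases n with
    | zero => simp at hn; linarith
    | succ n => exact Set.mem_iUnion.2 ⟨n, n, le_rfl, hn⟩
  refine (measure_mono hU).trans ?_
  rw [Monotone.measure_iUnion]
  · exact iSup_le hfin
  · intro a b hab ω ⟨k, hk, h⟩
    exact ⟨k, hk.trans hab, h⟩

/-- A line-crossing inequality for exponential moments: if `E exp (Y i) ≤ exp a`, then the sums
of the `Y i` stay below the line `n * a + log (1 / δ)`. -/
theorem measure_exists_line_crossing_le {Y : ℕ → Ω → ℝ} (hYm : ∀ i, Measurable (Y i))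
    (hYi : iIndepFun Y P) {b : ℝ} (hb : ∀ i ω, Y i ω ≤ b) {a : ℝ}
    (hmgf : ∀ i, ∫ ω, Real.exp (Y i ω) ∂P ≤ Real.exp a) {δ : ℝ} (hδ : 0 < δ) (hδ1 : δ < 1) :
    P {ω | ∃ n : ℕ, n * a + Real.log (1 / δ) ≤ ∑ i ∈ Finset.range n, Y i ω}
      ≤ ENNReal.ofReal δ := by
  have hint : ∀ i, Integrable (fun ω => Real.exp (Y i ω)) P := fun i =>
    Integrable.of_bound (hYm i).exp.aestronglyMeasurable (Real.exp b)
      (Filter.Eventually.of_forall fun ω => by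
        rw [Real.norm_eq_abs, Real.abs_exp]; exact Real.exp_le_exp.2 (hb i ω))
  -- Normalizing by the exact exponential moments gives mean one; the upper bound `hmgf` enters only
  -- at the end.
  set m : ℕ → ℝ := fun i => ∫ ω, Real.exp (Y i ω) ∂P with hm
  have hmpos : ∀ i, 0 < m i := fun i => integral_exp_pos (hint i)
  set Z : ℕ → Ω → ℝ := fun i ω => Real.exp (Y i ω) / m i with hZ
  have hV := measure_exists_le_prod_le (P := P) (Z := Z) (c := 1 / δ)
    (fun i => (hYm i).exp.div_const _)
    (hYi.comp (fun i x => Real.exp x / m i) fun i => Real.measurable_exp.div_const _)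
    (fun i => (hint i).div_const _)
    (fun i => by simp only [hZ, integral_div]; exact div_self (hmpos i).ne')
    (fun i ω => div_nonneg (Real.exp_pos _).le (hmpos i).le)
    (by rw [lt_div_iff₀ hδ]; linarith)
  simp only [one_div_one_div] at hV
  refine (measure_mono ?_).trans hV
  rintro ω ⟨n, hn⟩
  refine ⟨n, ?_⟩
  rw [hZ, Finset.prod_div_distrib, ← Real.exp_sum, le_div_iff₀ (Finset.prod_pos fun i _ => hmpos i)]
  calc 1 / δ * ∏ i ∈ Finset.range n, m i ≤ 1 / δ * ∏ i ∈ Finset.range n, Real.exp a := by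
        gcongr with i _
        exact hmgf i
    _ = Real.exp (n * a + Real.log (1 / δ)) := by
        rw [Real.exp_add, Real.exp_log (by positivity), Finset.prod_const, Finset.card_range,
          ← Real.exp_nat_mul]; ring
    _ ≤ _ := Real.exp_le_exp.2 hn

end Ville

/-! ### The iterated logarithm -/

theorem exp_one_le_log_max (x : ℝ) : Real.exp 1 ≤ Real.log (max x (Real.exp (Real.exp 1))) := by
  rw [Real.le_log_iff_exp_le (lt_max_of_lt_right (Real.exp_pos _))]
  exact le_max_right _ _

theorem one_le_log_max (x : ℝ) : 1 ≤ Real.log (max x (Real.exp (Real.exp 1))) :=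
  (Real.one_le_exp zero_le_one).trans (exp_one_le_log_max x)

theorem one_le_lnlnPlus (x : ℝ) : 1 ≤ lnlnPlus x := by
  rw [lnlnPlus, Real.le_log_iff_exp_le (by linarith [one_le_log_max x])]
  exact exp_one_le_log_max x

theorem lnlnPlus_mono {x y : ℝ} (h : x ≤ y) : lnlnPlus x ≤ lnlnPlus y :=
  Real.log_le_log (by linarith [one_le_log_max x])
    (Real.log_le_log (lt_max_of_lt_right (Real.exp_pos _)) (max_le_max_right _ h))

theorem lnlnPlus_le_log (x : ℝ) : lnlnPlus x ≤ Real.log (max x (Real.exp (Real.exp 1))) :=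
  (Real.log_le_sub_one_of_pos (by linarith [one_le_log_max x])).trans (by linarith)

/-- A factor A in the argument multiplies the inner logarithm by at most 1 + ln A, because that
logarithm is at least 1. -/
theorem lnlnPlus_mul_le {A : ℝ} (hA : 1 ≤ A) (x : ℝ) :
    lnlnPlus (A * x) ≤ lnlnPlus x + Real.log (1 + Real.log A) := by
  have hl : 0 ≤ Real.log A := Real.log_nonneg hA
  have h1 := one_le_log_max x
  have he : 0 < max x (Real.exp (Real.exp 1)) := lt_max_of_lt_right (Real.exp_pos _)
  have hmax : max (A * x) (Real.exp (Real.exp 1)) ≤ A * max x (Real.exp (Real.exp 1)) := by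
    refine max_le (by gcongr; exact le_max_left _ _) ?_
    calc Real.exp (Real.exp 1) ≤ max x (Real.exp (Real.exp 1)) := le_max_right _ _
      _ ≤ _ := le_mul_of_one_le_left he.le hA
  unfold lnlnPlus
  rw [← Real.log_mul (by linarith) (by linarith)]
  refine Real.log_le_log (by linarith [one_le_log_max (A * x)]) ?_
  refine (Real.log_le_log (lt_max_of_lt_right (Real.exp_pos _)) hmax).trans ?_
  rw [Real.log_mul (by linarith) he.ne']
  nlinarith

theorem log_le_div_add_log {x c : ℝ} (hx : 0 < x) (hc : 0 < c) :
    Real.log x ≤ x / c + Real.log c := by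
  have h := Real.log_le_sub_one_of_pos (div_pos hx hc)
  rw [Real.log_div hx.ne' hc.ne'] at h
  linarith

/-- The slope 1/c is free: a small slope allows an iterated logarithm of t to be absorbed into a
fraction of t. -/
theorem lnlnPlus_le_div_add {c : ℝ} (hc : 0 < c) :
    ∃ A, ∀ t, 0 ≤ t → lnlnPlus t ≤ t / c + A := by
  refine ⟨Real.exp (Real.exp 1) / c + Real.log c, fun t ht => ?_⟩
  have he := Real.exp_pos (Real.exp 1)
  have hm : 0 < max t (Real.exp (Real.exp 1)) := lt_max_of_lt_right he
  have h1 := (lnlnPlus_le_log t).trans (log_le_div_add_log hm hc)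
  have h2 : max t (Real.exp (Real.exp 1)) ≤ t + Real.exp (Real.exp 1) :=
    max_le (by linarith) (by linarith)
  have h3 : max t (Real.exp (Real.exp 1)) / c ≤ (t + Real.exp (Real.exp 1)) / c := by gcongr
  rw [add_div] at h3
  linarith

/-- The logarithmic confidence parameter used on the `k`-th geometric scale. -/
def scaleLog (L : ℝ) (k : ℕ) : ℝ := L + Real.log (2 * (k + 1) * (k + 2))

/-- The slope of the line used on the `k`-th geometric scale. -/
def scaleSlope (L : ℝ) (k : ℕ) : ℝ := min (1 / 2) (√(scaleLog L k / Real.exp (k + 1)))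

theorem log_scale_le (k : ℕ) :
    Real.log (2 * (k + 1) * (k + 2)) ≤ 2 + 2 * Real.log (k + 1) := by
  have h1 : Real.log (2 * (k + 1) * (k + 2)) ≤ Real.log (2 ^ 2 * (k + 1) ^ 2) := by
    apply Real.log_le_log (by positivity)
    nlinarith [(Nat.cast_nonneg k : (0 : ℝ) ≤ k)]
  rw [Real.log_mul (x := (2 : ℝ) ^ 2) (by norm_num) (by positivity), Real.log_pow,
    Real.log_pow] at h1
  have := Real.log_two_lt_d9
  push_cast at h1
  linarith

theorem one_le_scaleLog {L : ℝ} (hL : 0 ≤ L) (k : ℕ) : 1 ≤ scaleLog L k := by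
  have h : Real.log (2 ^ 2) ≤ Real.log (2 * (k + 1) * (k + 2)) := by
    apply Real.log_le_log (by norm_num)
    nlinarith [(Nat.cast_nonneg k : (0 : ℝ) ≤ k)]
  rw [Real.log_pow] at h
  have := Real.log_two_gt_d9
  push_cast at h
  unfold scaleLog
  linarith

theorem scaleSlope_pos {L : ℝ} (hL : 0 ≤ L) (k : ℕ) : 0 < scaleSlope L k :=
  lt_min (by norm_num) (Real.sqrt_pos.2 (div_pos (by linarith [one_le_scaleLog hL k])
    (Real.exp_pos _)))

theorem scaleSlope_le (L : ℝ) (k : ℕ) : scaleSlope L k ≤ 1 / 2 := min_le_left _ _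

/-- Take k with t on the scale e^k. There the slope λ = √(ℓ/e^(k+1)), where ℓ is `scaleLog L k`,
nearly minimizes λt + ℓ/λ, with value O(√(tℓ)), and ℓ exceeds L only by O(ln k) = O(lnln t). The cap
1/2 on the slope keeps |λX| ≤ 1 for |X| ≤ 2. -/
theorem exists_scale_le {L t : ℝ} (hL : 0 ≤ L) (ht : 0 ≤ t) :
    ∃ k : ℕ, scaleSlope L k * t + scaleLog L k / scaleSlope L k ≤
      64 * (1 + L + √(t * (lnlnPlus t + L))) := by
  set k := ⌊Real.log (max t 1)⌋₊ with hk
  have hm : 0 < max t 1 := by positivity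
  have hlog : 0 ≤ Real.log (max t 1) := Real.log_nonneg (le_max_right _ _)
  have hk1 : Real.exp k ≤ max t 1 := by
    rw [← Real.le_log_iff_exp_le hm]; exact Nat.floor_le hlog
  have hk2 : max t 1 ≤ Real.exp (k + 1) := by
    rw [← Real.log_le_iff_le_exp hm]; exact (Nat.lt_floor_add_one _).le
  have htk : t ≤ Real.exp (k + 1) := (le_max_left _ _).trans hk2
  have hs : 0 ≤ √(t * (lnlnPlus t + L)) := Real.sqrt_nonneg _
  have hH := one_le_scaleLog hL k
  have hHk : scaleLog L k ≤ L + 2 + 2 * Real.log (k + 1) := by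
    unfold scaleLog; linarith [log_scale_le k]
  have hlam := scaleSlope_pos hL k
  have hE := Real.exp_pos ((k : ℝ) + 1)
  refine ⟨k, ?_⟩
  rcases le_total (√(scaleLog L k / Real.exp (k + 1))) (1 / 2) with h | h
  · have hl : scaleSlope L k = √(scaleLog L k / Real.exp (k + 1)) := min_eq_right h
    set a := scaleLog L k
    set E := Real.exp ((k : ℝ) + 1)
    have hsa : √(a / E) = √a / √E := Real.sqrt_div (by linarith) _
    have ha : 0 < √a := Real.sqrt_pos.2 (by linarith)
    have hE' : 0 < √E := Real.sqrt_pos.2 hE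
    have hbound : scaleSlope L k * t + a / scaleSlope L k ≤ 2 * √(a * E) := by
      have h1 : scaleSlope L k * t ≤ √(a * E) := by
        rw [hl, hsa, Real.sqrt_mul (by linarith)]
        calc √a / √E * t ≤ √a / √E * E := by gcongr
          _ = √a * √E := by
            field_simp
            rw [Real.sq_sqrt hE.le]
      have h2 : a / scaleSlope L k = √(a * E) := by
        rw [hl, hsa, Real.sqrt_mul (by linarith)]
        field_simp
        rw [Real.sq_sqrt (by linarith)]
      linarith
    refine hbound.trans ?_
    have hE3 : E ≤ 3 * max t 1 := by
      have : E = Real.exp k * Real.exp 1 := Real.exp_add _ _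
      have h3 : Real.exp 1 ≤ 3 := by linarith [Real.exp_one_lt_d9]
      rw [this, mul_comm 3]
      gcongr
    rcases le_total t 1 with ht1 | ht1
    · have hk0 : k = 0 := by simp [hk, max_eq_right ht1]
      have ha2 : a ≤ L + 2 := by simpa [hk0] using hHk
      have : √(a * E) ≤ a + E := by
        rw [Real.sqrt_le_left (by linarith)]
        nlinarith
      rw [max_eq_right ht1] at hE3
      linarith
    · rw [max_eq_left ht1] at hE3
      have hl1 := one_le_lnlnPlus t
      have hlk : Real.log (k + 1) ≤ 2 * lnlnPlus t := by
        set y := Real.log (max t (Real.exp (Real.exp 1))) with hy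
        have hy1 : 1 ≤ y := one_le_log_max t
        have hky : (k : ℝ) ≤ y := by
          refine (Nat.floor_le hlog).trans ?_
          rw [max_eq_left ht1]
          exact Real.log_le_log (by linarith) (le_max_left _ _)
        have h2 : Real.log (k + 1) ≤ Real.log (2 * y) :=
          Real.log_le_log (by positivity) (by linarith)
        rw [Real.log_mul (by norm_num) (by linarith)] at h2
        have := Real.log_two_lt_d9
        have : lnlnPlus t = Real.log y := rfl
        linarith
      have ha6 : a ≤ 6 * (lnlnPlus t + L) := by linarith
      have : √(a * E) ≤ 5 * √(t * (lnlnPlus t + L)) := by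
        rw [Real.sqrt_le_left (by positivity), mul_pow, Real.sq_sqrt (by positivity)]
        calc a * E ≤ (6 * (lnlnPlus t + L)) * (3 * t) := by gcongr
          _ ≤ _ := by nlinarith [mul_nonneg ht (by linarith : 0 ≤ lnlnPlus t + L)]
      linarith
  -- The cap is active only if e^(k+1) ≤ 4ℓ. This bounds k in terms of L, so that ℓ ≤ 2L + 16 and
  -- both terms are O(1 + L).
  · have hl : scaleSlope L k = 1 / 2 := min_eq_left h
    rw [hl]
    have h4 : Real.exp (k + 1) ≤ 4 * scaleLog L k := by
      rw [Real.le_sqrt (by norm_num) (by positivity), le_div_iff₀ hE] at h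
      linarith
    have h5 := log_le_div_add_log (x := (k : ℝ) + 1) (c := 16) (by positivity) (by norm_num)
    have h6 := Real.add_one_le_exp ((k : ℝ) + 1)
    have h16 : Real.log 16 ≤ 3 := by
      have : (16 : ℝ) = 2 ^ 4 := by norm_num
      rw [this, Real.log_pow]
      have := Real.log_two_lt_d9
      push_cast
      linarith
    have : scaleLog L k ≤ 2 * L + 16 := by linarith
    linarith

/-! ### The uniform Bernstein inequality -/

theorem exp_le_one_add_add_sq {x : ℝ} (hx : |x| ≤ 1) : Real.exp x ≤ 1 + x + x ^ 2 := by
  have := (abs_le.1 (Real.abs_exp_sub_one_sub_id_le hx)).2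
  linarith

section

variable {Ω : Type} [MeasurableSpace Ω] {P : Measure Ω} [IsProbabilityMeasure P]

theorem IsCenteredIID.integrable {X : ℕ → Ω → ℝ} (hX : IsCenteredIID P X) (i : ℕ) :
    Integrable (X i) P :=
  Integrable.of_bound (hX.measurable i).aestronglyMeasurable 2
    (Filter.Eventually.of_forall fun ω => abs_le.2 ⟨(hX.mem_Icc i ω).1, (hX.mem_Icc i ω).2⟩)

omit [IsProbabilityMeasure P] in
theorem IsCenteredIID.sq_le {X : ℕ → Ω → ℝ} (hX : IsCenteredIID P X) (i : ℕ) (ω : Ω) :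
    X i ω ^ 2 ≤ 4 := by
  have := hX.mem_Icc i ω
  nlinarith [this.1, this.2]

theorem IsCenteredIID.integrable_sq {X : ℕ → Ω → ℝ} (hX : IsCenteredIID P X) (i : ℕ) :
    Integrable (fun ω => X i ω ^ 2) P :=
  Integrable.of_bound ((hX.measurable i).pow_const 2).aestronglyMeasurable 4
    (Filter.Eventually.of_forall fun ω => by
      rw [Real.norm_eq_abs, abs_of_nonneg (sq_nonneg _)]; exact hX.sq_le i ω)

omit [IsProbabilityMeasure P] in
theorem IsCenteredIID.neg {X : ℕ → Ω → ℝ} (hX : IsCenteredIID P X) :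
    IsCenteredIID P fun i ω => -X i ω where
  measurable i := (hX.measurable i).neg
  indep := hX.indep.comp (fun _ x => -x) fun _ => measurable_neg
  ident i := (hX.ident i).comp measurable_neg
  mem_Icc i ω := ⟨by linarith [(hX.mem_Icc i ω).2], by linarith [(hX.mem_Icc i ω).1]⟩
  mean := by rw [integral_neg, hX.mean, neg_zero]

/-- Integrate exp x ≤ 1 + x + x² on |x| ≤ 1; the linear term has mean zero. -/
theorem IsCenteredIID.mgf_le {X : ℕ → Ω → ℝ} (hX : IsCenteredIID P X) {v : ℝ}
    (hv : ∫ ω, X 0 ω ^ 2 ∂P ≤ v) {l : ℝ} (hl : |l| ≤ 1 / 2) (i : ℕ) :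
    ∫ ω, Real.exp (l * X i ω) ∂P ≤ Real.exp (l ^ 2 * v) := by
  have h0 : ∫ ω, Real.exp (l * X i ω) ∂P = ∫ ω, Real.exp (l * X 0 ω) ∂P :=
    ((hX.ident i).comp (u := fun x => Real.exp (l * x)) (by fun_prop)).integral_eq
  rw [h0]
  have hb : ∀ ω, |l * X 0 ω| ≤ 1 := fun ω => by
    rw [abs_mul]
    have : |X 0 ω| ≤ 2 := abs_le.2 ⟨(hX.mem_Icc 0 ω).1, (hX.mem_Icc 0 ω).2⟩
    nlinarith [abs_nonneg l, abs_nonneg (X 0 ω)]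
  have hI : Integrable (fun ω => 1 + l * X 0 ω + l ^ 2 * X 0 ω ^ 2) P :=
    ((integrable_const _).add ((hX.integrable 0).const_mul l)).add
      ((hX.integrable_sq 0).const_mul _)
  have hI1 : Integrable (fun ω => 1 + l * X 0 ω) P :=
    (integrable_const _).add ((hX.integrable 0).const_mul l)
  calc ∫ ω, Real.exp (l * X 0 ω) ∂P ≤ ∫ ω, (1 + l * X 0 ω + l ^ 2 * X 0 ω ^ 2) ∂P := by
        refine integral_mono_of_nonneg (Filter.Eventually.of_forall fun ω => (Real.exp_pos _).le)
          hI (Filter.Eventually.of_forall fun ω => ?_)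
        exact (exp_le_one_add_add_sq (hb ω)).trans (by rw [mul_pow])
    _ = 1 + l ^ 2 * ∫ ω, X 0 ω ^ 2 ∂P := by
        rw [integral_add hI1 ((hX.integrable_sq 0).const_mul _),
          integral_add (integrable_const _) ((hX.integrable 0).const_mul l),
          integral_const_mul, integral_const_mul, hX.mean]
        simp
    _ ≤ 1 + l ^ 2 * v := by gcongr
    _ ≤ _ := by linarith [Real.add_one_le_exp (l ^ 2 * v)]

theorem IsCenteredIID.measure_line_le {X : ℕ → Ω → ℝ} (hX : IsCenteredIID P X) {v : ℝ}
    (hv : ∫ ω, X 0 ω ^ 2 ∂P ≤ v) {l : ℝ} (hl0 : 0 < l) (hl : l ≤ 1 / 2) {δ : ℝ} (hδ : 0 < δ)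
    (hδ1 : δ < 1) :
    P {ω | ∃ n : ℕ, l * (n * v) + Real.log (1 / δ) / l ≤ ∑ i ∈ Finset.range n, X i ω}
      ≤ ENNReal.ofReal δ := by
  have h := measure_exists_line_crossing_le (P := P) (Y := fun i ω => l * X i ω) (b := 1)
    (a := l ^ 2 * v) (fun i => (hX.measurable i).const_mul l)
    (hX.indep.comp (fun _ x => l * x) fun _ => measurable_id.const_mul l)
    (fun i ω => by nlinarith [(hX.mem_Icc i ω).2])
    (hX.mgf_le hv (by rw [abs_of_pos hl0]; exact hl)) hδ hδ1
  refine (measure_mono ?_).trans h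
  rintro ω ⟨n, hn⟩
  refine ⟨n, ?_⟩
  rw [← Finset.mul_sum]
  calc n * (l ^ 2 * v) + Real.log (1 / δ)
      = l * (l * (n * v) + Real.log (1 / δ) / l) := by field_simp
    _ ≤ _ := by gcongr

/-- Telescoping sum. The total is δ/2, so that upper and lower tails together cost δ. -/
theorem tsum_ofReal_scale_le {δ : ℝ} (hδ : 0 ≤ δ) :
    ∑' k : ℕ, ENNReal.ofReal (δ / (2 * (k + 1) * (k + 2))) ≤ ENNReal.ofReal (δ / 2) := by
  refine ENNReal.tsum_le_of_sum_range_le fun n => ?_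
  rw [← ENNReal.ofReal_sum_of_nonneg fun k _ => by positivity]
  apply ENNReal.ofReal_le_ofReal
  have h : ∀ n : ℕ, ∑ k ∈ Finset.range n, δ / (2 * ((k : ℝ) + 1) * (k + 2))
      = δ / 2 * (1 - 1 / (n + 1)) := by
    intro n
    induction n with
    | zero => simp
    | succ n ih =>
      rw [Finset.sum_range_succ, ih]
      push_cast
      field_simp
      ring
  rw [h]
  have : (0 : ℝ) ≤ 1 / (n + 1) := by positivity
  nlinarith

/-- Stitching: a sum beyond the curved boundary lies above the line of some scale, and the crossing
probabilities of the lines are summable. The scale is chosen from n·v rather than n, so the bound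
improves with small variance; the empirical version depends on this. -/
theorem IsCenteredIID.measure_upper_le {X : ℕ → Ω → ℝ} (hX : IsCenteredIID P X) {v : ℝ}
    (hv : ∫ ω, X 0 ω ^ 2 ∂P ≤ v) {δ : ℝ} (hδ : 0 < δ) (hδ1 : δ < 1) :
    P {ω | ∃ n : ℕ, 64 * (1 + Real.log (1 / δ) +
        √(n * v * (lnlnPlus (n * v) + Real.log (1 / δ)))) < ∑ i ∈ Finset.range n, X i ω}
      ≤ ENNReal.ofReal (δ / 2) := by
  have hv0 : 0 ≤ v := (integral_nonneg fun ω => sq_nonneg _).trans hv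
  have hL : 0 ≤ Real.log (1 / δ) := Real.log_nonneg (by rw [le_div_iff₀ hδ]; linarith)
  have hδk : ∀ k : ℕ, Real.log (1 / (δ / (2 * (k + 1) * (k + 2)))) = scaleLog (Real.log (1 / δ)) k := by
    intro k
    rw [scaleLog, ← Real.log_mul (by positivity) (by positivity)]
    congr 1
    field_simp
  have hsub : {ω | ∃ n : ℕ, 64 * (1 + Real.log (1 / δ) +
        √(n * v * (lnlnPlus (n * v) + Real.log (1 / δ)))) < ∑ i ∈ Finset.range n, X i ω} ⊆
      ⋃ k : ℕ, {ω | ∃ n : ℕ, scaleSlope (Real.log (1 / δ)) k * (n * v) +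
        Real.log (1 / (δ / (2 * (k + 1) * (k + 2)))) / scaleSlope (Real.log (1 / δ)) k
          ≤ ∑ i ∈ Finset.range n, X i ω} := by
    rintro ω ⟨n, hn⟩
    obtain ⟨k, hk⟩ := exists_scale_le (t := n * v) hL (by positivity)
    refine Set.mem_iUnion.2 ⟨k, n, ?_⟩
    rw [hδk]
    exact hk.trans hn.le
  refine (measure_mono hsub).trans ((measure_iUnion_le _).trans (le_trans ?_
    (tsum_ofReal_scale_le hδ.le)))
  refine ENNReal.tsum_le_tsum fun k => ?_
  refine hX.measure_line_le hv (scaleSlope_pos hL k) (scaleSlope_le _ k) (by positivity) ?_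
  rw [div_lt_one (by positivity)]
  nlinarith [(Nat.cast_nonneg k : (0 : ℝ) ≤ k)]

/-- The uniform Bernstein inequality with the scale of the law of the iterated logarithm. -/
theorem IsCenteredIID.measure_abs_le {X : ℕ → Ω → ℝ} (hX : IsCenteredIID P X) {v : ℝ}
    (hv : ∫ ω, X 0 ω ^ 2 ∂P ≤ v) {δ : ℝ} (hδ : 0 < δ) (hδ1 : δ < 1) :
    P {ω | ∃ n : ℕ, 64 * (1 + Real.log (1 / δ) +
        √(n * v * (lnlnPlus (n * v) + Real.log (1 / δ)))) < |∑ i ∈ Finset.range n, X i ω|}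
      ≤ ENNReal.ofReal δ := by
  have h1 := hX.measure_upper_le hv hδ hδ1
  have h2 := hX.neg.measure_upper_le (v := v) (by simpa using hv) hδ hδ1
  have : ENNReal.ofReal δ = ENNReal.ofReal (δ / 2) + ENNReal.ofReal (δ / 2) := by
    rw [← ENNReal.ofReal_add (by positivity) (by positivity), add_halves]
  rw [this]
  refine (measure_mono ?_).trans ((measure_union_le _ _).trans (add_le_add h1 h2))
  rintro ω ⟨n, hn⟩
  rcases lt_abs.1 hn with h | h
  · exact Or.inl ⟨n, h⟩
  · refine Or.inr ⟨n, ?_⟩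
    rwa [Finset.sum_neg_distrib]

end

theorem firstEntries_sum (X : ℕ → ℝ) (n : ℕ) :
    (firstEntries X n).sum = ∑ i ∈ Finset.range n, X i := by
  rw [firstEntries, Finset.sum_range]
  induction n with
  | zero => simp
  | succ n ih => simp [List.range_succ, Fin.sum_univ_castSucc, ih]

@[simp] theorem firstEntries_length (X : ℕ → ℝ) (n : ℕ) : (firstEntries X n).length = n := by
  simp [firstEntries]

theorem ofReal_one_sub_le_of_compl {Ω : Type*} [MeasurableSpace Ω] {P : Measure Ω}
    [IsProbabilityMeasure P] {s t : Set Ω} {δ : ℝ} (hδ : 0 ≤ δ) (h : P s ≤ ENNReal.ofReal δ)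
    (hst : tᶜ ⊆ s) : ENNReal.ofReal (1 - δ) ≤ P t := by
  rw [ENNReal.ofReal_sub _ hδ, ENNReal.ofReal_one, tsub_le_iff_right]
  calc (1 : ENNReal) = P Set.univ := measure_univ.symm
    _ ≤ P (t ∪ s) := measure_mono fun ω _ => by
        by_cases hω : ω ∈ t
        · exact Or.inl hω
        · exact Or.inr (hst hω)
    _ ≤ P t + P s := measure_union_le _ _
    _ ≤ _ := by gcongr

theorem uniformBernstein_of_const : UniformBernstein 64 := by
  intro Ω _ P _ X hX δ hδ
  have hv : ∫ ω, X 0 ω ^ 2 ∂P ≤ 4 := by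
    calc ∫ ω, X 0 ω ^ 2 ∂P ≤ ∫ _, (4 : ℝ) ∂P :=
          integral_mono (hX.integrable_sq 0) (integrable_const _) (hX.sq_le 0)
      _ = 4 := by simp
  refine ofReal_one_sub_le_of_compl hδ.1.le (hX.measure_abs_le hv hδ.1 hδ.2) ?_
  intro ω hω
  simp only [Set.mem_compl_iff, Set.mem_ofPred_eq, not_forall, not_le] at hω
  obtain ⟨n, hn⟩ := hω
  refine ⟨n, ?_⟩
  rw [firstEntries_sum, thresholdP, mul_comm (4 : ℝ)] at hn
  exact hn

/-! ### The empirical Bernstein inequality -/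

theorem empVar_firstEntries (X : ℕ → ℝ) (n : ℕ) :
    empVar (firstEntries X n) = (n : ℝ) / (n - 1) *
      (∑ i ∈ Finset.range n, X i ^ 2 - 1 / n * (∑ i ∈ Finset.range n, X i) ^ 2) := by
  have : (firstEntries X n).map (fun x => x ^ 2) = firstEntries (fun i => X i ^ 2) n := by
    simp [firstEntries, Function.comp_def]
  rw [empVar, this, firstEntries_sum, firstEntries_sum, firstEntries_length]

theorem sum_sq_sub_nonneg (X : ℕ → ℝ) (n : ℕ) :
    0 ≤ ∑ i ∈ Finset.range n, X i ^ 2 - 1 / n * (∑ i ∈ Finset.range n, X i) ^ 2 := by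
  rcases Nat.eq_zero_or_pos n with rfl | hn
  · simp
  have h := sq_sum_le_card_mul_sum_sq (s := Finset.range n) (f := X)
  rw [Finset.card_range] at h
  have hn' : (0 : ℝ) < n := by exact_mod_cast hn
  rw [sub_nonneg, one_div, inv_mul_le_iff₀ hn']
  exact h

theorem empVar_firstEntries_nonneg (X : ℕ → ℝ) (n : ℕ) : 0 ≤ empVar (firstEntries X n) := by
  rw [empVar_firstEntries]
  rcases Nat.eq_zero_or_pos n with rfl | hn
  · simp
  have hn' : (1 : ℝ) ≤ n := by exact_mod_cast hn
  exact mul_nonneg (div_nonneg (by linarith) (by linarith)) (sum_sq_sub_nonneg X n)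

theorem le_empVar_firstEntries (X : ℕ → ℝ) {n : ℕ} (hn : 2 ≤ n) :
    ∑ i ∈ Finset.range n, X i ^ 2 - 1 / n * (∑ i ∈ Finset.range n, X i) ^ 2
      ≤ empVar (firstEntries X n) := by
  rw [empVar_firstEntries]
  have hn' : (2 : ℝ) ≤ n := by exact_mod_cast hn
  refine le_mul_of_one_le_left (sum_sq_sub_nonneg X n) ?_
  rw [le_div_iff₀ (by linarith)]
  linarith

/-- The empirical variance is invariant under translations. -/
theorem empVar_firstEntries_sub_const (X : ℕ → ℝ) (c : ℝ) (n : ℕ) :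
    empVar (firstEntries (fun i => X i - c) n) = empVar (firstEntries X n) := by
  rw [empVar_firstEntries, empVar_firstEntries]
  rcases Nat.eq_zero_or_pos n with rfl | hn
  · simp
  have hn' : (n : ℝ) ≠ 0 := by positivity
  congr 1
  have : ∀ i, (X i - c) ^ 2 = X i ^ 2 - 2 * c * X i + c ^ 2 := fun i => by ring
  simp_rw [this, Finset.sum_add_distrib, Finset.sum_sub_distrib, ← Finset.mul_sum]
  simp only [Finset.sum_const, Finset.card_range, nsmul_eq_mul]
  field_simp
  ring

/-- The deterministic half of the empirical inequality. Put t = n·s. The Bernstein bound on S, with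
L ≤ n and s ≤ 4, gives S²/n = O(1 + L + lnln t). Inserted into the lower bound for V this yields t ≤
A·w, so t may be replaced by w in the bound on S. The term L + 1 leaves room for running the two
probabilistic bounds at level δ/2. -/
theorem exists_empirical_bound : ∃ D : ℝ, ∀ (n : ℕ) (L s S V : ℝ), 1 ≤ n → 0 ≤ L → L ≤ n →
    0 ≤ s → s ≤ 4 → 0 ≤ V →
    |S| ≤ 64 * (1 + (L + 1) + √(n * s * (lnlnPlus (n * s) + (L + 1)))) →
    (n = 1 → |S| ≤ 2) → (2 ≤ n → n * s / 2 - 8 * (L + 1) - 1 / n * S ^ 2 ≤ V) →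
    |S| ≤ thresholdQ D V (Real.exp (-L)) := by
  -- 131072 = 4·32768: the term 32768·lnln t in the bound on S²/n is then at most t/4 plus a
  -- constant, which leaves t/4 of the t/2 in the lower bound for V.
  obtain ⟨A₀, hA₀⟩ := lnlnPlus_le_div_add (c := 131072) (by norm_num)
  set A₁ := max A₀ 0
  -- 81928 = 8 + 6·8192 + 32768 collects the constants in the resulting bound on t/4; it also covers
  -- the coefficients of L and V.
  set A := 4 * (81928 + 32768 * A₁) with hA
  have hA₁ : 0 ≤ A₁ := le_max_right _ _
  have hA1 : 1 ≤ A := by linarith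
  set B := Real.log (1 + Real.log A)
  have hB : 0 ≤ B := Real.log_nonneg (by linarith [Real.log_nonneg hA1])
  refine ⟨128 * (A * (2 + B)), fun n L s S V hn hL hLn hs hs4 hV hS h1 h2 => ?_⟩
  have hn' : (1 : ℝ) ≤ n := by exact_mod_cast hn
  set w := V + L + 1 with hw
  have hlog : Real.log (1 / Real.exp (-L)) = L := by
    rw [one_div, ← Real.exp_neg, neg_neg, Real.log_exp]
  rw [thresholdQ, hlog]
  have hw1 : 1 ≤ w := by linarith
  have hl1 := one_le_lnlnPlus w
  have hAB : 2 ≤ A * (2 + B) := by nlinarith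
  have hsq : 0 ≤ √(w * (lnlnPlus w + L)) := Real.sqrt_nonneg _
  -- At n = 1 the empirical variance carries no information, but |S| ≤ 2 is below the constant term.
  rcases Nat.lt_or_ge n 2 with hn2 | hn2
  · refine (h1 (by omega)).trans ?_
    nlinarith
  set t := n * s with ht
  have ht0 : 0 ≤ t := by positivity
  have hlt := one_le_lnlnPlus t
  have hS2 : 1 / n * S ^ 2 ≤ 8192 * (3 * (L + 2) + 4 * (lnlnPlus t + (L + 1))) := by
    have hr : 0 ≤ t * (lnlnPlus t + (L + 1)) := by positivity
    have e1 : S ^ 2 ≤ 8192 * ((L + 2) ^ 2 + t * (lnlnPlus t + (L + 1))) := by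
      have e2 : |S| ^ 2 ≤ (64 * (1 + (L + 1) + √(t * (lnlnPlus t + (L + 1))))) ^ 2 := by gcongr
      rw [sq_abs] at e2
      nlinarith [Real.sq_sqrt hr, sq_nonneg ((L + 2) - √(t * (lnlnPlus t + (L + 1))))]
    rw [one_div, inv_mul_le_iff₀ (by linarith)]
    refine e1.trans ?_
    have e3 : (L + 2) ^ 2 ≤ n * (3 * (L + 2)) := by nlinarith
    have e4 : t * (lnlnPlus t + (L + 1)) ≤ n * (4 * (lnlnPlus t + (L + 1))) := by
      rw [ht, mul_assoc]; gcongr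
    linarith
  have hA' := hA₀ t ht0
  have hmax : A₀ ≤ A₁ := le_max_left _ _
  have htw : t ≤ A * w := by
    have := h2 hn2
    nlinarith [mul_nonneg hA₁ hL, mul_nonneg hA₁ hV]
  have hlt2 : lnlnPlus t ≤ lnlnPlus w + B := (lnlnPlus_mono htw).trans (lnlnPlus_mul_le hA1 w)
  have hfac : lnlnPlus t + (L + 1) ≤ (2 + B) * (lnlnPlus w + L) := by nlinarith
  have hsqrt : √(t * (lnlnPlus t + (L + 1))) ≤ (A * (2 + B)) * √(w * (lnlnPlus w + L)) := by
    rw [Real.sqrt_le_left (by positivity), mul_pow, Real.sq_sqrt (by positivity)]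
    calc t * (lnlnPlus t + (L + 1)) ≤ (A * w) * ((2 + B) * (lnlnPlus w + L)) := by gcongr
      _ = (A * (2 + B)) * (w * (lnlnPlus w + L)) := by ring
      _ ≤ _ := by
        have : 0 ≤ w * (lnlnPlus w + L) := by positivity
        gcongr
        nlinarith
  refine hS.trans ?_
  nlinarith

section

variable {Ω : Type} [MeasurableSpace Ω] {P : Measure Ω} [IsProbabilityMeasure P]

/-- The variables -X²/8 lie in [-1/2, 0], where exp x ≤ 1 + x/2. Their exponential moments are
therefore at most exp(-v/16), and the line crossing inequality applies. -/
theorem IsCenteredIID.measure_sum_sq_le {X : ℕ → Ω → ℝ} (hX : IsCenteredIID P X) {δ : ℝ}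
    (hδ : 0 < δ) (hδ1 : δ < 1) :
    P {ω | ∃ n : ℕ, ∑ i ∈ Finset.range n, X i ω ^ 2 ≤
      n * (∫ ω, X 0 ω ^ 2 ∂P) / 2 - 8 * Real.log (1 / δ)} ≤ ENNReal.ofReal δ := by
  set v := ∫ ω, X 0 ω ^ 2 ∂P with hv
  have hm : ∀ i, ∫ ω, Real.exp (-(X i ω ^ 2) / 8) ∂P ≤ Real.exp (-v / 16) := by
    intro i
    have h0 : ∫ ω, Real.exp (-(X i ω ^ 2) / 8) ∂P = ∫ ω, Real.exp (-(X 0 ω ^ 2) / 8) ∂P :=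
      ((hX.ident i).comp (u := fun x => Real.exp (-(x ^ 2) / 8)) (by fun_prop)).integral_eq
    rw [h0]
    have hI : Integrable (fun ω => 1 - X 0 ω ^ 2 / 16) P :=
      (integrable_const _).sub ((hX.integrable_sq 0).div_const _)
    calc ∫ ω, Real.exp (-(X 0 ω ^ 2) / 8) ∂P ≤ ∫ ω, (1 - X 0 ω ^ 2 / 16) ∂P := by
          refine integral_mono_of_nonneg
            (Filter.Eventually.of_forall fun ω => (Real.exp_pos _).le)
            hI (Filter.Eventually.of_forall fun ω => ?_)
          have h4 := hX.sq_le 0 ω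
          have h5 := sq_nonneg (X 0 ω)
          refine (exp_le_one_add_add_sq (abs_le.2 ⟨by linarith, by linarith⟩)).trans ?_
          dsimp only
          nlinarith
      _ = 1 - v / 16 := by
          rw [integral_sub (integrable_const _) ((hX.integrable_sq 0).div_const _), integral_div]
          simp [hv]
      _ ≤ _ := by linarith [Real.add_one_le_exp (-v / 16)]
  have h := measure_exists_line_crossing_le (P := P) (Y := fun i ω => -(X i ω ^ 2) / 8) (b := 0)
    (fun i => (((hX.measurable i).pow_const 2).neg).div_const 8)
    (hX.indep.comp (fun _ x => -(x ^ 2) / 8) fun _ => by fun_prop)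
    (fun i ω => by nlinarith [sq_nonneg (X i ω)]) hm hδ hδ1
  refine (measure_mono ?_).trans h
  rintro ω ⟨n, hn⟩
  refine ⟨n, ?_⟩
  rw [← Finset.sum_div, Finset.sum_neg_distrib]
  linarith

end

theorem exists_uniformEmpiricalBernstein : ∃ D₁ : ℝ, UniformEmpiricalBernstein D₁ := by
  obtain ⟨D, hD⟩ := exists_empirical_bound
  refine ⟨D, ?_⟩
  intro Ω _ P _ X hX δ hδ
  have hδ0 := hδ.1
  have hδ1 := hδ.2
  have h1 := hX.measure_abs_le le_rfl (δ := δ / 2) (by linarith) (by linarith)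
  have h2 := hX.measure_sum_sq_le (δ := δ / 2) (by linarith) (by linarith)
  set v := ∫ ω, X 0 ω ^ 2 ∂P with hv
  have hv0 : 0 ≤ v := integral_nonneg fun ω => sq_nonneg _
  have hv4 : v ≤ 4 := by
    calc ∫ ω, X 0 ω ^ 2 ∂P ≤ ∫ _, (4 : ℝ) ∂P :=
          integral_mono (hX.integrable_sq 0) (integrable_const _) (hX.sq_le 0)
      _ = 4 := by simp
  have h12 := (measure_union_le _ _).trans (add_le_add h1 h2)
  rw [← ENNReal.ofReal_add (by linarith) (by linarith), add_halves] at h12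
  refine ofReal_one_sub_le_of_compl hδ0.le h12 fun ω hω => ?_
  by_contra hcon
  refine hω fun n hn => ?_
  simp only [Set.mem_union, Set.mem_ofPred_eq, not_or, not_exists, not_lt, not_le] at hcon
  have hL : 0 < Real.log (1 / δ) := Real.log_pos (by rw [lt_div_iff₀ hδ0]; linarith)
  have hL2 : Real.log (1 / (δ / 2)) ≤ Real.log (1 / δ) + 1 := by
    have : 1 / (δ / 2) = 1 / δ * 2 := by field_simp
    rw [this, Real.log_mul (by positivity) (by norm_num)]
    linarith [Real.log_two_lt_d9]
  have hn1 : 1 ≤ n := by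
    have : (0 : ℝ) < n := hL.trans_le hn
    exact_mod_cast this
  have hexp : Real.exp (-Real.log (1 / δ)) = δ := by
    rw [Real.log_div one_ne_zero hδ0.ne', Real.log_one, zero_sub, neg_neg, Real.exp_log hδ0]
  have hl := one_le_lnlnPlus (n * v)
  have hX1 := hcon.1 n
  have hX2 := hcon.2 n
  have key := hD n (Real.log (1 / δ)) v (∑ i ∈ Finset.range n, X i ω)
    (empVar (firstEntries (X · ω) n)) hn1 hL.le hn hv0 hv4 (empVar_firstEntries_nonneg _ n)
    (hX1.trans (by gcongr)) (fun h => by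
      subst h
      simpa using abs_le.2 ⟨(hX.mem_Icc 0 ω).1, (hX.mem_Icc 0 ω).2⟩)
    (fun h => by
      have := le_empVar_firstEntries (X · ω) h
      linarith)
  rw [hexp] at key
  rw [firstEntries_sum]
  exact key

/-! ### Sequences obtained from a product measure -/

section Product

variable {ι κ α : Type*} [MeasurableSpace α]

/-- Disjoint groups of coordinates of a product measure are independent. -/
theorem map_infinitePi_curry_of_inj {J : Type*} {μ : ι → Measure α}
    [∀ i, IsProbabilityMeasure (μ i)]
    {ν : J → κ → Measure α} [∀ j b, IsProbabilityMeasure (ν j b)] {e : J × κ → ι}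
    (he : Function.Injective e) (hμ : ∀ j b, μ (e (j, b)) = ν j b) :
    (Measure.infinitePi μ).map (fun ω j b => ω (e (j, b)))
      = Measure.infinitePi fun j => Measure.infinitePi (ν j) := by
  rw [← Measure.infinitePi_map_curry]
  have h := Measure.map_infinitePi_infinitePi_of_inj (P := μ) he
  have h2 : (fun p : J × κ => μ (e p)) = fun p : J × κ => ν p.1 p.2 := by
    ext1 p; exact hμ p.1 p.2
  rw [h2] at h
  rw [← h, Measure.map_map (by fun_prop) (by fun_prop)]
  rfl

end Product

/-- Injectivity of `e` makes the blocks `e (i, ·)` disjoint, hence independent, and by `hμ` all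
blocks have the same law. Every concrete sequence to which one of the two uniform inequalities is
applied arises in this way. -/
theorem isCenteredIID_infinitePi {ι κ α : Type} [MeasurableSpace α]
    {μ : ι → Measure α} [∀ i, IsProbabilityMeasure (μ i)]
    {ν : κ → Measure α} [∀ b, IsProbabilityMeasure (ν b)] {e : ℕ × κ → ι}
    (he : Function.Injective e) (hμ : ∀ i b, μ (e (i, b)) = ν b) {h : (κ → α) → ℝ}
    (hm : Measurable h) (hmem : ∀ z, h z ∈ Set.Icc (-2 : ℝ) 2)
    (hmean : ∫ z, h z ∂(Measure.infinitePi ν) = 0) :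
    IsCenteredIID (Measure.infinitePi μ) (fun i ω => h fun b => ω (e (i, b))) := by
  have hT := map_infinitePi_curry_of_inj (ν := fun _ : ℕ => ν) he hμ
  have hlaw : ∀ i, (Measure.infinitePi μ).map (fun ω b => ω (e (i, b))) = Measure.infinitePi ν := by
    intro i
    have h1 := congrArg (Measure.map (fun z : ℕ → κ → α => z i)) hT
    rw [Measure.map_map (by fun_prop) (by fun_prop), Measure.infinitePi_map_eval] at h1
    exact h1
  have hmap : ∀ i, (Measure.infinitePi μ).map (fun ω => h fun b => ω (e (i, b)))
      = (Measure.infinitePi ν).map h := by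
    intro i
    rw [← hlaw i, Measure.map_map hm (by fun_prop)]
    rfl
  have hmeas : ∀ i, Measurable fun ω : ι → α => h fun b => ω (e (i, b)) := fun i =>
    hm.comp (by fun_prop)
  refine ⟨hmeas, ?_, fun i => ⟨(hmeas i).aemeasurable, (hmeas 0).aemeasurable, ?_⟩,
    fun i ω => hmem _, ?_⟩
  · rw [iIndepFun_iff_map_fun_eq_infinitePi_map hmeas]
    simp_rw [hmap]
    rw [← Measure.infinitePi_map_pi (μ := fun _ : ℕ => Measure.infinitePi ν) (fun _ => hm), ← hT,
      Measure.map_map (by fun_prop) (by fun_prop)]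
    rfl
  · rw [hmap, hmap]
  · have := integral_map (μ := Measure.infinitePi μ) (φ := fun ω b => ω (e (0, b))) (f := h)
      (Measurable.aemeasurable (by fun_prop)) hm.aestronglyMeasurable
    rw [hlaw] at this
    rw [← this, hmean]

/-! ### The constants are positive -/

/-- A nondegenerate test sequence: since |X 0| = 1, the uniform inequalities at n = 1 force the
constants to be positive. -/
theorem exists_rademacher : ∃ (Ω : Type) (_ : MeasurableSpace Ω) (P : Measure Ω)
    (_ : IsProbabilityMeasure P) (X : ℕ → Ω → ℝ), IsCenteredIID P X ∧ ∀ i ω, |X i ω| = 1 := by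
  let h : Bool → ℝ := fun b => cond b 1 (-1)
  have hh : ∀ b, |h b| = 1 := by intro b; cases b <;> simp [h]
  refine ⟨ℕ × Unit → Bool, inferInstance,
    Measure.infinitePi fun _ => (PMF.uniformOfFintype Bool).toMeasure, inferInstance,
    fun i ω => h (ω (i, ())), ?_, fun i ω => hh _⟩
  refine isCenteredIID_infinitePi (ν := fun _ : Unit => (PMF.uniformOfFintype Bool).toMeasure)
    (e := id) (h := fun z => h (z ())) Function.injective_id (fun _ _ => rfl)
    (measurable_of_countable _)
    (fun z => by
      have := abs_le.1 (hh (z ())).le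
      exact ⟨by linarith [this.1], by linarith [this.2]⟩) ?_
  have := integral_map (μ := Measure.infinitePi fun _ : Unit =>
    (PMF.uniformOfFintype Bool).toMeasure) (φ := fun z => z ()) (f := h)
      (Measurable.aemeasurable (by fun_prop)) (measurable_of_countable _).aestronglyMeasurable
  rw [Measure.infinitePi_map_eval, PMF.integral_eq_sum] at this
  rw [← this]
  simp [h]

theorem nonempty_of_ofReal_le {Ω : Type*} [MeasurableSpace Ω] {P : Measure Ω} {s : Set Ω} {r : ℝ}
    (hr : 0 < r) (h : ENNReal.ofReal r ≤ P s) : s.Nonempty :=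
  nonempty_of_measure_ne_zero ((ENNReal.ofReal_pos.2 hr).trans_le h).ne'

theorem UniformBernstein.pos {D₀ : ℝ} (h : UniformBernstein D₀) : 0 < D₀ := by
  obtain ⟨Ω, _, P, _, X, hX, hX1⟩ := exists_rademacher
  obtain ⟨ω, hω⟩ := nonempty_of_ofReal_le (by norm_num) (h Ω P X hX (1 / 2) (by norm_num))
  have h1 := hω 1
  rw [firstEntries_sum, thresholdP, Finset.sum_range_one, hX1] at h1
  have hL : 0 ≤ Real.log (1 / (1 / 2)) := Real.log_nonneg (by norm_num)
  by_contra hcon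
  have : 0 ≤ 1 + Real.log (1 / (1 / 2)) +
    √(4 * ((1 : ℕ) : ℝ) * (lnlnPlus (4 * ((1 : ℕ) : ℝ)) + Real.log (1 / (1 / 2)))) := by positivity
  nlinarith

theorem UniformEmpiricalBernstein.pos {D₁ : ℝ} (h : UniformEmpiricalBernstein D₁) : 0 < D₁ := by
  obtain ⟨Ω, _, P, _, X, hX, hX1⟩ := exists_rademacher
  obtain ⟨ω, hω⟩ := nonempty_of_ofReal_le (by norm_num) (h Ω P X hX (1 / 2) (by norm_num))
  have hL : 0 ≤ Real.log (1 / (1 / 2)) := Real.log_nonneg (by norm_num)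
  -- The index n = 1 is admissible because ln 2 ≤ 1.
  have h1 := hω 1 (by
    rw [one_div_one_div]
    have := Real.log_two_lt_d9
    norm_num
    linarith)
  rw [firstEntries_sum, thresholdQ, Finset.sum_range_one, hX1] at h1
  by_contra hcon
  have : 0 ≤ 1 + Real.log (1 / (1 / 2)) + √((empVar (firstEntries (X · ω) 1) +
    Real.log (1 / (1 / 2)) + 1) * (lnlnPlus (empVar (firstEntries (X · ω) 1) +
    Real.log (1 / (1 / 2)) + 1) + Real.log (1 / (1 / 2)))) := by positivity
  nlinarith

/-! ### Strict forms of the concentration inequalities -/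

theorem log_one_div_nonneg {δ : ℝ} (hδ : 0 < δ) (hδ1 : δ ≤ 1) : 0 ≤ Real.log (1 / δ) :=
  Real.log_nonneg (by rw [le_div_iff₀ hδ]; linarith)

theorem log_one_div_lt {δ δ' : ℝ} (hδ : 0 < δ) (h : δ < δ') :
    Real.log (1 / δ') < Real.log (1 / δ) :=
  Real.log_lt_log (by have := hδ.trans h; positivity) (one_div_lt_one_div_of_lt hδ h)

theorem thresholdP_pos {D₀ : ℝ} (hD : 0 < D₀) (n : ℕ) {δ : ℝ} (hδ : 0 < δ) (hδ1 : δ ≤ 1) :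
    0 < thresholdP D₀ n δ := by
  have := log_one_div_nonneg hδ hδ1
  unfold thresholdP
  positivity

theorem thresholdP_lt {D₀ : ℝ} (hD : 0 < D₀) (n : ℕ) {δ δ' : ℝ} (hδ : 0 < δ) (h : δ < δ') :
    thresholdP D₀ n δ' < thresholdP D₀ n δ := by
  have hl := log_one_div_lt hδ h
  unfold thresholdP
  refine mul_lt_mul_of_pos_left (add_lt_add_of_lt_of_le (by linarith) ?_) hD
  gcongr

theorem thresholdQ_lt {D₁ : ℝ} (hD : 0 < D₁) {v : ℝ} (hv : 0 ≤ v) {δ δ' : ℝ} (hδ : 0 < δ)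
    (h : δ < δ') (hδ' : δ' ≤ 1) : thresholdQ D₁ v δ' < thresholdQ D₁ v δ := by
  have hl := log_one_div_lt hδ h
  have h0 := log_one_div_nonneg (hδ.trans h) hδ'
  have hm := lnlnPlus_mono (by linarith :
    v + Real.log (1 / δ') + 1 ≤ v + Real.log (1 / δ) + 1)
  have h1 := one_le_lnlnPlus (v + Real.log (1 / δ') + 1)
  unfold thresholdQ
  refine mul_lt_mul_of_pos_left (add_lt_add_of_lt_of_le (by linarith) ?_) hD
  apply Real.sqrt_le_sqrt
  gcongr
  linarith

/-- A test succeeds already at equality, which the uniform inequalities do not exclude. At a level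
δ' > δ the threshold is strictly smaller, so success at level δ violates the inequality at level δ';
then let δ' tend to δ. -/
theorem le_ofReal_of_forall_gt {x : ENNReal} {δ : ℝ} (hδ : 0 ≤ δ) (hδ1 : δ < 1)
    (h : ∀ δ', δ < δ' → δ' < 1 → x ≤ ENNReal.ofReal δ') : x ≤ ENNReal.ofReal δ := by
  have hx : x ≠ ⊤ := ne_top_of_le_ne_top ENNReal.ofReal_ne_top
    (h ((δ + 1) / 2) (by linarith) (by linarith))
  rw [← ENNReal.ofReal_toReal hx]
  apply ENNReal.ofReal_le_ofReal
  by_contra! hcon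
  set δ' := min ((δ + 1) / 2) ((δ + x.toReal) / 2)
  have h1 : δ < δ' := lt_min (by linarith) (by linarith)
  have h2 := ENNReal.toReal_mono ENNReal.ofReal_ne_top
    (h δ' h1 ((min_le_left _ _).trans_lt (by linarith)))
  rw [ENNReal.toReal_ofReal (hδ.trans h1.le)] at h2
  have := min_le_right ((δ + 1) / 2) ((δ + x.toReal) / 2)
  linarith

theorem measure_compl_le_of_ofReal_le {Ω : Type*} [MeasurableSpace Ω] {P : Measure Ω}
    [IsProbabilityMeasure P] {s : Set Ω} (hs : MeasurableSet s) {δ : ℝ}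
    (h : ENNReal.ofReal (1 - δ) ≤ P s) : P sᶜ ≤ ENNReal.ofReal δ := by
  rw [prob_compl_eq_one_sub hs, tsub_le_iff_right]
  calc (1 : ENNReal) = ENNReal.ofReal (δ + (1 - δ)) := by simp
    _ ≤ ENNReal.ofReal δ + ENNReal.ofReal (1 - δ) := ENNReal.ofReal_add_le
    _ ≤ _ := by gcongr

section

variable {Ω : Type} [MeasurableSpace Ω] {P : Measure Ω} [IsProbabilityMeasure P]

theorem UniformBernstein.measure_exists_le {D₀ : ℝ} (h : UniformBernstein D₀) {X : ℕ → Ω → ℝ}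
    (hX : IsCenteredIID P X) {δ : ℝ} (hδ : 0 < δ) (hδ1 : δ < 1) :
    P {ω | ∃ n, thresholdP D₀ n δ ≤ ∑ i ∈ Finset.range n, X i ω} ≤ ENNReal.ofReal δ := by
  refine le_ofReal_of_forall_gt hδ.le hδ1 fun δ' h1 h2 => ?_
  have hms : MeasurableSet {ω | ∀ n : ℕ, |(firstEntries (X · ω) n).sum| ≤ thresholdP D₀ n δ'} := by
    simp_rw [firstEntries_sum]
    have := hX.measurable
    simp only [Set.ofPred_forall]
    refine MeasurableSet.iInter fun n => ?_
    exact measurableSet_le (by fun_prop) measurable_const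
  refine (measure_mono ?_).trans
    (measure_compl_le_of_ofReal_le hms (h Ω P X hX δ' ⟨by linarith, h2⟩))
  rintro ω ⟨n, hn⟩ hcon
  have h3 := hcon n
  rw [firstEntries_sum] at h3
  linarith [le_abs_self (∑ i ∈ Finset.range n, X i ω), thresholdP_lt h.pos n hδ h1]

theorem UniformEmpiricalBernstein.measure_exists_le {D₁ : ℝ} (h : UniformEmpiricalBernstein D₁)
    {X : ℕ → Ω → ℝ} (hX : IsCenteredIID P X) {δ : ℝ} (hδ : 0 < δ) (hδ1 : δ < 1) :
    P {ω | ∃ n : ℕ, Real.log (1 / δ) ≤ n ∧ thresholdQ D₁ (empVar (firstEntries (X · ω) n)) δ ≤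
      ∑ i ∈ Finset.range n, X i ω} ≤ ENNReal.ofReal δ := by
  refine le_ofReal_of_forall_gt hδ.le hδ1 fun δ' h1 h2 => ?_
  have hms : MeasurableSet {ω | ∀ n : ℕ, Real.log (1 / δ') ≤ n →
      |(firstEntries (X · ω) n).sum| ≤ thresholdQ D₁ (empVar (firstEntries (X · ω) n)) δ'} := by
    simp_rw [firstEntries_sum, empVar_firstEntries, thresholdQ, lnlnPlus]
    have := hX.measurable
    simp only [Set.ofPred_forall]
    refine MeasurableSet.iInter fun n => MeasurableSet.iInter fun _ => ?_
    exact measurableSet_le (by fun_prop) (by fun_prop)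
  refine (measure_mono ?_).trans
    (measure_compl_le_of_ofReal_le hms (h Ω P X hX δ' ⟨by linarith, h2⟩))
  rintro ω ⟨n, hn, hn2⟩ hcon
  have h3 := hcon n ((log_one_div_lt hδ h1).le.trans hn)
  rw [firstEntries_sum] at h3
  linarith [le_abs_self (∑ i ∈ Finset.range n, X i ω),
    thresholdQ_lt h.pos (empVar_firstEntries_nonneg (X · ω) n) hδ h1 h2.le]

end

/-! ### The subsequence of the answers that are not abstentions -/

instance : DecidableEq Response := Classical.decEq _

instance : Fintype Response :=
  ⟨{.zero, .one, .abstain}, fun x => by cases x <;> simp⟩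

theorem Response.sum_eq {E : Type*} [AddCommMonoid E] (F : Response → E) :
    ∑ y, F y = F .zero + F .one + F .abstain := by
  have : (Finset.univ : Finset Response) = {.zero, .one, .abstain} := rfl
  rw [this, Finset.sum_insert (by simp), Finset.sum_insert (by simp), Finset.sum_singleton,
    add_assoc]

/-- The positions at which `p` holds can be enumerated by an injective map. -/
theorem exists_injective_enumeration (p : ℕ → Prop) [DecidablePred p] :
    ∃ e : ℕ → ℕ, Function.Injective e ∧ ∀ n, p n → e (Nat.count p n) = n := by
  by_cases hf : (Set.ofPred p).Finite
  · obtain ⟨B, hB⟩ := hf.bddAbove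
    -- After the finitely many positions are exhausted, the enumeration continues beyond their bound
    -- B, which preserves injectivity.
    refine ⟨fun j => if j < hf.toFinset.card then Nat.nth p j else B + 1 + j, ?_, ?_⟩
    · have hlt : ∀ j, j < hf.toFinset.card → Nat.nth p j ≤ B := fun j hj =>
        hB (Nat.nth_mem_of_lt_card hf hj)
      intro i j hij
      dsimp only at hij
      split_ifs at hij with h1 h2 h2
      · exact Nat.nth_injOn hf h1 h2 hij
      · have := hlt i h1; omega
      · have := hlt j h2; omega
      · omega
    · intro n hn
      dsimp only
      rw [if_pos (Nat.count_lt_card hf hn), Nat.nth_count hn]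
  · exact ⟨Nat.nth p, Nat.nth_injective hf, fun n hn => Nat.nth_count hn⟩

theorem sum_ite_eq_sum_count {p : ℕ → Prop} [DecidablePred p] {e : ℕ → ℕ}
    (he : ∀ n, p n → e (Nat.count p n) = n) (F : ℕ → ℝ) (n : ℕ) :
    ∑ i ∈ Finset.range n, (if p i then F i else 0) =
      ∑ j ∈ Finset.range (Nat.count p n), F (e j) := by
  induction n with
  | zero => simp
  | succ n ih =>
    rw [Finset.sum_range_succ, ih, Nat.count_succ]
    by_cases hn : p n
    · simp [hn, Finset.sum_range_succ, he n hn]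
    · simp [hn]

/-- Replaces an abstention by a label. -/
def Response.label : Response → Response
  | .zero => .zero
  | _ => .one

/-- The response with abstention pattern `a` and label `y`. -/
def Response.combine (a y : Response) : Response :=
  if a = .abstain then .abstain else y.label

section

variable {μ : Measure Response} [IsProbabilityMeasure μ]

/-- An answer can be drawn in two independent stages: a response used only to decide about
abstention, and a label from the law conditioned on answering. The conditional law gives no mass to
abstention, so the arbitrary choice made by `Response.label` there is harmless. -/
theorem map_combine (hμ : μ {.abstain} ≠ 1) :
    (μ.prod (μ[|{.abstain}ᶜ])).map (fun z => Response.combine z.1 z.2) = μ := by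
  have hc : μ {Response.abstain}ᶜ ≠ 0 := by
    rw [prob_compl_eq_one_sub (MeasurableSet.singleton _)]
    exact fun h => hμ (le_antisymm prob_le_one (tsub_eq_zero_iff_le.1 h))
  have := cond_isProbabilityMeasure hc
  have hcf : μ {Response.abstain}ᶜ ≠ ⊤ := measure_ne_top _ _
  have hsub : ∀ y : Response, y ≠ .abstain →
      μ {Response.abstain}ᶜ * (μ[|{Response.abstain}ᶜ]) {y} = μ {y} := by
    intro y hy
    rw [cond_apply (MeasurableSet.singleton _).compl, ← mul_assoc, ENNReal.mul_inv_cancel hc hcf,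
      one_mul, Set.inter_eq_right.2 (by simpa using hy.symm)]
  have h0 : (μ[|{Response.abstain}ᶜ]) {Response.abstain} = 0 := by
    rw [cond_apply (MeasurableSet.singleton _).compl]; simp
  refine Measure.ext_of_singleton fun y => ?_
  rw [Measure.map_apply (measurable_of_countable _) (MeasurableSet.singleton _)]
  have hone : (fun z : Response × Response => Response.combine z.1 z.2) ⁻¹' {Response.one} =
      {Response.abstain}ᶜ ×ˢ ({Response.one} ∪ {Response.abstain}) := by
    ext ⟨a, y⟩; cases a <;> cases y <;> simp [Response.combine, Response.label]
  have hzero : (fun z : Response × Response => Response.combine z.1 z.2) ⁻¹' {Response.zero} =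
      {Response.abstain}ᶜ ×ˢ {Response.zero} := by
    ext ⟨a, y⟩; cases a <;> cases y <;> simp [Response.combine, Response.label]
  have habs : (fun z : Response × Response => Response.combine z.1 z.2) ⁻¹' {Response.abstain} =
      {Response.abstain} ×ˢ Set.univ := by
    ext ⟨a, y⟩; cases a <;> cases y <;> simp [Response.combine, Response.label]
  cases y with
  | zero => rw [hzero, Measure.prod_prod, hsub _ (by simp)]
  | one =>
    rw [hone, Measure.prod_prod, measure_union (by simp) (MeasurableSet.singleton _), h0, add_zero,
      hsub _ (by simp)]
  | abstain => rw [habs, Measure.prod_prod, measure_univ, mul_one]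

/-- The two-stage drawing in every round: one product measure over `Bool × ℕ` is grouped by stage
and by round. -/
theorem map_combine_infinitePi (hμ : μ {.abstain} ≠ 1) :
    ((Measure.infinitePi fun _ : ℕ => μ).prod
      (Measure.infinitePi fun _ : ℕ => μ[|{.abstain}ᶜ])).map
        (fun z i => Response.combine (z.1 i) (z.2 i)) = Measure.infinitePi fun _ : ℕ => μ := by
  have hc : μ {Response.abstain}ᶜ ≠ 0 := by
    rw [prob_compl_eq_one_sub (MeasurableSet.singleton _)]
    exact fun h => hμ (le_antisymm prob_le_one (tsub_eq_zero_iff_le.1 h))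
  have := cond_isProbabilityMeasure hc
  let ν : Bool → Measure Response := fun b => cond b (μ[|{.abstain}ᶜ]) μ
  have hν : ∀ b, IsProbabilityMeasure (ν b) := by
    intro b
    cases b
    · exact ‹IsProbabilityMeasure μ›
    · exact this
  have hcm : Measurable fun z : Response × Response => Response.combine z.1 z.2 :=
    measurable_of_countable _
  have h1 := map_infinitePi_curry_of_inj (μ := fun p : Bool × ℕ => ν p.1)
    (ν := fun (b : Bool) (_ : ℕ) => ν b) (e := id) Function.injective_id (fun _ _ => rfl)
  have h2 := map_infinitePi_curry_of_inj (μ := fun p : Bool × ℕ => ν p.1)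
    (ν := fun (_ : ℕ) (b : Bool) => ν b) (e := Prod.swap) Prod.swap_injective (fun _ _ => rfl)
  have h3 := Measure.infinitePi_map_eval_prod
    (P := fun b : Bool => Measure.infinitePi fun _ : ℕ => ν b) (i := false) (j := true) (by simp)
  have h4 := Measure.infinitePi_map_eval_prod (P := ν) (i := false) (j := true) (by simp)
  have hg : (Measure.infinitePi ν).map (fun z => Response.combine (z false) (z true)) = μ := by
    have h5 := congrArg (Measure.map fun z : Response × Response => Response.combine z.1 z.2) h4
    rw [Measure.map_map hcm (by fun_prop)] at h5
    exact h5.trans (map_combine hμ)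
  have hgm : Measurable fun z : Bool → Response => Response.combine (z false) (z true) :=
    measurable_of_countable _
  change (((Measure.infinitePi fun _ : ℕ => ν false).prod
      (Measure.infinitePi fun _ : ℕ => ν true)).map
        (fun z i => Response.combine (z.1 i) (z.2 i))) = _
  have hm1 : Measurable fun (z : (ℕ → Response) × (ℕ → Response)) (i : ℕ) =>
      Response.combine (z.1 i) (z.2 i) := by
    exact measurable_pi_lambda _ fun i =>
      hcm.comp (f := fun z : (ℕ → Response) × (ℕ → Response) => (z.1 i, z.2 i)) (by fun_prop)
  rw [← h3, ← h1, Measure.map_map hm1 (by fun_prop), Measure.map_map (by fun_prop) (by fun_prop)]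
  have h5 := Measure.infinitePi_map_pi (μ := fun _ : ℕ => Measure.infinitePi ν)
    (f := fun _ z => Response.combine (z false) (z true)) (fun _ => hgm)
  rw [← h2, hg] at h5
  have hm2 : Measurable fun (z : ℕ → Bool → Response) (i : ℕ) =>
      Response.combine (z i false) (z i true) :=
    measurable_pi_lambda _ fun i => hgm.comp (measurable_pi_apply i)
  rw [← h5, Measure.map_map hm2 (by fun_prop)]
  rfl

end

theorem measurable_count_answers (n : ℕ) :
    Measurable fun X : ℕ → Response => Nat.count (fun i => X i ≠ .abstain) n := by
  induction n with
  | zero => simp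
  | succ n ih =>
    simp_rw [Nat.count_succ]
    exact ih.add ((measurable_of_countable (fun y : Response =>
      if y ≠ .abstain then 1 else 0)).comp (measurable_pi_apply n))

/-- The concentration inequality behind `CheckSignificant`, for the subsequence of the answers
that are not abstentions. -/
theorem UniformBernstein.measure_answers_le {D₀ : ℝ} (hD : UniformBernstein D₀)
    {μ : Measure Response} [IsProbabilityMeasure μ] (hμ : μ {.abstain} ≠ 1) {h : Response → ℝ}
    (hmem : ∀ y, h y ∈ Set.Icc (-2 : ℝ) 2)
    (hmean : h .zero * μ.real {.zero} + h .one * μ.real {.one} = 0)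
    {δ : ℝ} (hδ : 0 < δ) (hδ1 : δ < 1) :
    (Measure.infinitePi fun _ : ℕ => μ) {X | ∃ n,
      thresholdP D₀ (Nat.count (fun i => X i ≠ .abstain) n) δ ≤
        ∑ i ∈ Finset.range n, if X i ≠ .abstain then h (X i) else 0} ≤ ENNReal.ofReal δ := by
  have hc : μ {Response.abstain}ᶜ ≠ 0 := by
    rw [prob_compl_eq_one_sub (MeasurableSet.singleton _)]
    exact fun h => hμ (le_antisymm prob_le_one (tsub_eq_zero_iff_le.1 h))
  have hq := cond_isProbabilityMeasure hc
  set E : Set (ℕ → Response) := {X | ∃ n,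
      thresholdP D₀ (Nat.count (fun i => X i ≠ .abstain) n) δ ≤
        ∑ i ∈ Finset.range n, if X i ≠ .abstain then h (X i) else 0} with hE
  have hEm : MeasurableSet E := by
    rw [hE]
    simp only [Set.ofPred_exists]
    refine MeasurableSet.iUnion fun n => measurableSet_le
      ((measurable_of_countable (fun k : ℕ => thresholdP D₀ k δ)).comp
        (measurable_count_answers n)) (Finset.measurable_fun_sum _ fun i _ => ?_)
    exact (measurable_of_countable (fun y : Response => if y ≠ .abstain then h y else 0)).comp
      (measurable_pi_apply i)
  have hcm : Measurable fun (z : (ℕ → Response) × (ℕ → Response)) (i : ℕ) =>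
      Response.combine (z.1 i) (z.2 i) :=
    measurable_pi_lambda _ fun i => (measurable_of_countable
      (fun z : Response × Response => Response.combine z.1 z.2)).comp
        (f := fun z : (ℕ → Response) × (ℕ → Response) => (z.1 i, z.2 i)) (by fun_prop)
  -- Fix the abstention pattern a. The labels at the answered rounds are read along an injective
  -- enumeration, hence are i.i.d., and the number of answers after n rounds is a deterministic
  -- index for the uniform inequality. Integration over a follows by Fubini.
  have hpat : ∀ a : ℕ → Response, (Measure.infinitePi fun _ : ℕ => μ[|{.abstain}ᶜ])
      (Prod.mk a ⁻¹' ((fun z i => Response.combine (z.1 i) (z.2 i)) ⁻¹' E))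
        ≤ ENNReal.ofReal δ := by
    intro a
    obtain ⟨e, he, hec⟩ := exists_injective_enumeration fun i => a i ≠ .abstain
    have hiid : IsCenteredIID (Measure.infinitePi fun _ : ℕ => μ[|{.abstain}ᶜ])
        (fun j y => h (y (e j)).label) := by
      refine isCenteredIID_infinitePi (κ := Unit) (ν := fun _ => μ[|{.abstain}ᶜ])
        (e := fun p => e p.1) (h := fun z => h (z ()).label)
        (fun p q hpq => Prod.ext (he hpq) rfl) (fun _ _ => rfl) (measurable_of_countable _)
        (fun z => hmem _) ?_
      have := integral_map (μ := Measure.infinitePi fun _ : Unit => μ[|{.abstain}ᶜ])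
        (φ := fun z => z ()) (f := fun y => h y.label)
        (Measurable.aemeasurable (by fun_prop)) (measurable_of_countable _).aestronglyMeasurable
      rw [Measure.infinitePi_map_eval, integral_fintype .of_finite] at this
      rw [← this, Response.sum_eq]
      have hr : ∀ y : Response, y ≠ .abstain → (μ[|{Response.abstain}ᶜ]).real {y}
          = (μ.real {Response.abstain}ᶜ)⁻¹ * μ.real {y} := by
        intro y hy
        rw [measureReal_def, cond_apply (MeasurableSet.singleton _).compl,
          Set.inter_eq_right.2 (by simpa using hy.symm), ENNReal.toReal_mul, ENNReal.toReal_inv]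
        rfl
      have h0 : (μ[|{Response.abstain}ᶜ]).real {Response.abstain} = 0 := by
        rw [measureReal_def, cond_apply (MeasurableSet.singleton _).compl]; simp
      rw [h0, hr _ (by simp), hr _ (by simp)]
      simp only [Response.label, smul_eq_mul]
      linear_combination (μ.real {Response.abstain}ᶜ)⁻¹ * hmean
    refine (measure_mono ?_).trans (hD.measure_exists_le hiid hδ hδ1)
    rintro y ⟨n, hn⟩
    have hca : ∀ i, Response.combine (a i) (y i) ≠ .abstain ↔ a i ≠ .abstain := by
      intro i
      cases a i <;> cases y i <;> simp [Response.combine, Response.label]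
    simp only [hca] at hn
    refine ⟨Nat.count (fun i => a i ≠ .abstain) n, hn.trans_eq ?_⟩
    rw [← sum_ite_eq_sum_count hec fun i => h (y i).label]
    refine Finset.sum_congr rfl fun i _ => ?_
    by_cases hi : a i = .abstain
    · simp [hi]
    · simp [hi, Response.combine]
  rw [← map_combine_infinitePi hμ, Measure.map_apply hcm hEm, Measure.prod_apply (hcm hEm)]
  calc _ ≤ ∫⁻ _, ENNReal.ofReal δ ∂(Measure.infinitePi fun _ : ℕ => μ) := lintegral_mono hpat
    _ = _ := by simp

/-! ### The tests of one epoch -/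

/-- The law of the responses in one epoch, where `ρ t` is the law of the response at `t`. -/
def epochLaw (ρ : ℝ → PMF Response) : Measure (ℕ × ℝ → Response) :=
  Measure.infinitePi fun p : ℕ × ℝ => (ρ p.2).toMeasure

instance (ρ : ℝ → PMF Response) : IsProbabilityMeasure (epochLaw ρ) := by
  unfold epochLaw; infer_instance

theorem map_column_epochLaw (ρ : ℝ → PMF Response) (t : ℝ) :
    (epochLaw ρ).map (fun z i => z (i, t)) = Measure.infinitePi fun _ : ℕ => (ρ t).toMeasure :=
  Measure.map_infinitePi_infinitePi_of_inj (f := fun i : ℕ => (i, t))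
    (fun _ _ h => (Prod.ext_iff.1 h).1)

/-- Stated as an inequality, which holds for arbitrary events and avoids measurability. -/
theorem epochLaw_column_le (ρ : ℝ → PMF Response) (t : ℝ) (E : Set (ℕ → Response)) :
    epochLaw ρ {z | (fun i => z (i, t)) ∈ E} ≤
      (Measure.infinitePi fun _ : ℕ => (ρ t).toMeasure) E := by
  rw [← map_column_epochLaw]
  exact Measure.le_map_apply (Measurable.aemeasurable (by fun_prop)) E

theorem pmf_measureReal_singleton (p : PMF Response) (y : Response) :
    p.toMeasure.real {y} = (p y).toReal := by
  rw [measureReal_def, PMF.toMeasure_apply_singleton _ _ (MeasurableSet.singleton _)]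

theorem pmf_sum_toReal (p : PMF Response) :
    (p .zero).toReal + (p .one).toReal + (p .abstain).toReal = 1 := by
  have h := p.tsum_coe
  rw [tsum_fintype, Response.sum_eq] at h
  rw [← ENNReal.toReal_add (p.apply_ne_top _) (p.apply_ne_top _), ← ENNReal.toReal_add
    (ENNReal.add_ne_top.2 ⟨p.apply_ne_top _, p.apply_ne_top _⟩) (p.apply_ne_top _), h,
    ENNReal.toReal_one]

theorem integral_answered (p : PMF Response) :
    ∫ y, y.answered ∂p.toMeasure = 1 - (p .abstain).toReal := by
  rw [PMF.integral_eq_sum, Response.sum_eq]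
  simp only [Response.answered, smul_eq_mul]
  linarith [pmf_sum_toReal p]

theorem Response.answered_mem (y : Response) : 0 ≤ y.answered ∧ y.answered ≤ 1 := by
  cases y <;> simp [Response.answered]

/-- The test on abstentions rarely succeeds if abstentions are more likely at `s` than at `t`. -/
theorem UniformEmpiricalBernstein.epochLaw_test_le {D₁ : ℝ} (hD : UniformEmpiricalBernstein D₁)
    (ρ : ℝ → PMF Response) {s t : ℝ} (hst : s ≠ t)
    (h : (ρ t .abstain).toReal ≤ (ρ s .abstain).toReal) {δ : ℝ} (hδ : 0 < δ) (hδ1 : δ < 1) :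
    epochLaw ρ {z | ∃ n, CheckSignificantVar D₁
      (firstEntries (fun i => (z (i, s)).answered - (z (i, t)).answered) n) δ} ≤
        ENNReal.ofReal δ := by
  set c := (ρ t .abstain).toReal - (ρ s .abstain).toReal with hc
  have ht := pmf_sum_toReal (ρ t)
  have hs := pmf_sum_toReal (ρ s)
  have hnn : ∀ (p : PMF Response) y, 0 ≤ (p y).toReal := fun p y => ENNReal.toReal_nonneg
  have hc1 : -1 ≤ c := by
    linarith [hnn (ρ s) .zero, hnn (ρ s) .one, hnn (ρ t) .abstain]
  let ν : Bool → Measure Response := fun b => (ρ (cond b t s)).toMeasure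
  have hint : ∀ b, ∫ z : Bool → Response, (z b).answered ∂(Measure.infinitePi ν)
      = 1 - (ρ (cond b t s) .abstain).toReal := by
    intro b
    rw [← integral_answered]
    have := integral_map (μ := Measure.infinitePi ν) (φ := fun z => z b)
      (f := Response.answered) (Measurable.aemeasurable (by fun_prop))
      (measurable_of_countable _).aestronglyMeasurable
    rw [Measure.infinitePi_map_eval] at this
    exact this.symm
  have hI : ∀ b, Integrable (fun z : Bool → Response => (z b).answered) (Measure.infinitePi ν) :=
    fun b => Integrable.of_bound (measurable_of_countable _).aestronglyMeasurable 1
      (Filter.Eventually.of_forall fun z => by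
        have := Response.answered_mem (z b)
        rw [Real.norm_eq_abs, abs_of_nonneg this.1]; exact this.2)
  have hiid : IsCenteredIID (epochLaw ρ)
      (fun i z => (z (i, s)).answered - (z (i, t)).answered - c) := by
    refine isCenteredIID_infinitePi (ν := ν) (e := fun p : ℕ × Bool => (p.1, cond p.2 t s))
      (h := fun z => (z false).answered - (z true).answered - c) ?_ (fun _ _ => rfl)
      (measurable_of_countable _) (fun z => ?_) ?_
    · rintro ⟨i, b⟩ ⟨j, b'⟩ hij
      obtain ⟨h1, h2⟩ := Prod.ext_iff.1 hij
      refine Prod.ext h1 ?_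
      cases b <;> cases b' <;> simp_all
    · have h1 := Response.answered_mem (z false)
      have h2 := Response.answered_mem (z true)
      exact ⟨by linarith, by linarith⟩
    · have hI2 : Integrable (fun z : Bool → Response => (z false).answered - (z true).answered)
          (Measure.infinitePi ν) := (hI false).sub (hI true)
      rw [integral_sub hI2 (integrable_const _),
        integral_sub (hI false) (hI true), hint, hint]
      simp [hc]
  refine (measure_mono ?_).trans (hD.measure_exists_le hiid hδ hδ1)
  rintro z ⟨n, hn1, hn2⟩
  rw [firstEntries_length] at hn1
  refine ⟨n, hn1, ?_⟩
  -- Centering leaves the empirical variance unchanged and, since the mean c is at most 0, can only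
  -- increase the sum. Success of the test thus passes to the centered sequence.
  rw [empVar_firstEntries_sub_const]
  refine hn2.trans ?_
  rw [firstEntries_sum, Finset.sum_sub_distrib _ (fun _ => c)]
  simp only [Finset.sum_const, Finset.card_range, nsmul_eq_mul]
  nlinarith [(Nat.cast_nonneg n : (0 : ℝ) ≤ n)]

/-- The sign of a label. -/
def Response.sgn : Response → ℝ
  | .zero => -1
  | .one => 1
  | .abstain => 0

theorem signArray_succ (X : ℕ → Response) (n : ℕ) :
    signArray X (n + 1) = signArray X n ++ (X n).sign?.toList := by
  rw [signArray, List.range_succ, List.filterMap_append]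
  simp only [signArray, List.append_cancel_left_eq]
  cases h : X n <;> simp [h, Response.sign?]

theorem signArray_length (X : ℕ → Response) (n : ℕ) :
    (signArray X n).length = Nat.count (fun i => X i ≠ .abstain) n := by
  induction n with
  | zero => simp [signArray]
  | succ n ih =>
    rw [signArray_succ, List.length_append, ih, Nat.count_succ]
    cases X n <;> simp [Response.sign?]

theorem signArray_sum (X : ℕ → Response) (n : ℕ) :
    (signArray X n).sum = ∑ i ∈ Finset.range n, (X i).sgn := by
  induction n with
  | zero => simp [signArray]
  | succ n ih =>
    rw [signArray_succ, List.sum_append, ih, Finset.sum_range_succ]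
    cases X n <;> simp [Response.sign?, Response.sgn]

theorem list_sum_map_neg (S : List ℝ) : (S.map fun b => -b).sum = -S.sum := by
  induction S with
  | nil => simp
  | cons a S ih => simp [ih]; ring

theorem sum_ite_answers (X : ℕ → Response) (σ c : ℝ) (n : ℕ) :
    (∑ i ∈ Finset.range n, if X i ≠ .abstain then σ * (X i).sgn - c else 0) =
      σ * ∑ i ∈ Finset.range n, (X i).sgn - c * Nat.count (fun i => X i ≠ .abstain) n := by
  induction n with
  | zero => simp
  | succ n ih =>
    rw [Finset.sum_range_succ, ih, Finset.sum_range_succ, Nat.count_succ]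
    cases X n <;> simp [Response.sgn] <;> ring

theorem pmf_toMeasure_abstain_ne_one {p : PMF Response} (hp : (p .abstain).toReal ≠ 1) :
    p.toMeasure {Response.abstain} ≠ 1 := by
  rw [PMF.toMeasure_apply_singleton _ _ (MeasurableSet.singleton _)]
  intro h
  rw [h] at hp
  simp at hp

/-- Uniform concentration of the signs of the labels at a point `t`. -/
theorem UniformBernstein.epochLaw_sgn_le {D₀ : ℝ} (hD : UniformBernstein D₀)
    (ρ : ℝ → PMF Response) (t : ℝ) (hρ : (ρ t .abstain).toReal ≠ 1) {σ : ℝ} (hσ : |σ| = 1)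
    {δ : ℝ} (hδ : 0 < δ) (hδ1 : δ < 1) :
    epochLaw ρ {z | ∃ n, thresholdP D₀ (Nat.count (fun i => z (i, t) ≠ .abstain) n) δ ≤
      σ * ∑ i ∈ Finset.range n, (z (i, t)).sgn -
        σ * (((ρ t .one).toReal - (ρ t .zero).toReal) / (1 - (ρ t .abstain).toReal)) *
          Nat.count (fun i => z (i, t) ≠ .abstain) n} ≤ ENNReal.ofReal δ := by
  set r0 := (ρ t .zero).toReal with hr0
  set r1 := (ρ t .one).toReal with hr1
  set a := (ρ t .abstain).toReal with ha
  have hsum : r0 + r1 + a = 1 := pmf_sum_toReal (ρ t)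
  have h0 : 0 ≤ r0 := ENNReal.toReal_nonneg
  have h1 : 0 ≤ r1 := ENNReal.toReal_nonneg
  have ha1 : 0 < 1 - a := lt_of_le_of_ne (by linarith) (by intro h; exact hρ (by linarith))
  set c := (r1 - r0) / (1 - a) with hc
  have hcabs : |c| ≤ 1 := by
    rw [hc, abs_div, abs_of_pos ha1, div_le_one ha1, abs_le]
    constructor <;> linarith
  have hcm : c * (1 - a) = r1 - r0 := div_mul_cancel₀ _ ha1.ne'
  have key := hD.measure_answers_le (μ := (ρ t).toMeasure) (pmf_toMeasure_abstain_ne_one hρ)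
    (h := fun y => σ * y.sgn - σ * c)
    (fun y => by
      have hs : |y.sgn| ≤ 1 := by cases y <;> simp [Response.sgn]
      have : |σ * y.sgn - σ * c| ≤ 2 := by
        rw [← mul_sub, abs_mul, hσ, one_mul]
        exact (abs_sub _ _).trans (by linarith)
      exact abs_le.1 this)
    (by
      rw [pmf_measureReal_singleton, pmf_measureReal_singleton, ← hr0, ← hr1]
      simp only [Response.sgn]
      have : r0 + r1 = 1 - a := by linarith
      linear_combination (-σ * c) * this - σ * hcm) hδ hδ1
  refine (measure_mono ?_).trans ((epochLaw_column_le ρ t _).trans key)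
  rintro z ⟨n, hn⟩
  refine ⟨n, ?_⟩
  rw [sum_ite_answers (fun i => z (i, t))]
  exact hn

/-- The test on labels rarely succeeds in the direction of the less likely label. -/
theorem UniformBernstein.epochLaw_test_le {D₀ : ℝ} (hD : UniformBernstein D₀)
    (ρ : ℝ → PMF Response) (t : ℝ) {σ : ℝ} (hσ : |σ| = 1)
    (h : (ρ t .abstain).toReal ≠ 1 → σ * ((ρ t .one).toReal - (ρ t .zero).toReal) ≤ 0)
    {δ : ℝ} (hδ : 0 < δ) (hδ1 : δ < 1) :
    epochLaw ρ {z | ∃ n, thresholdP D₀ (signArray (fun i => z (i, t)) n).length δ ≤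
      σ * (signArray (fun i => z (i, t)) n).sum} ≤ ENNReal.ofReal δ := by
  simp_rw [signArray_length, signArray_sum]
  -- If the labeler always abstains at t, the array is almost surely empty and cannot reach the
  -- positive threshold; otherwise the conditional law exists.
  by_cases hρ : (ρ t .abstain).toReal = 1
  · have hone : ρ t .abstain = 1 := by
      rw [← ENNReal.toReal_eq_one_iff]; exact hρ
    have hnull : (Measure.infinitePi fun _ : ℕ => (ρ t).toMeasure)
        {X | ∃ i, X i ≠ .abstain} = 0 := by
      simp only [Set.ofPred_exists]
      refine measure_iUnion_null fun i => ?_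
      have h1 := congrArg (fun μ => μ {Response.abstain}ᶜ)
        (Measure.infinitePi_map_eval (fun _ : ℕ => (ρ t).toMeasure) i)
      rw [Measure.map_apply (by fun_prop) (MeasurableSet.singleton _).compl,
        prob_compl_eq_one_sub (MeasurableSet.singleton _),
        PMF.toMeasure_apply_singleton _ _ (MeasurableSet.singleton _), hone, tsub_self] at h1
      exact h1
    refine (measure_mono ?_).trans ((epochLaw_column_le ρ t _).trans (hnull.le.trans zero_le))
    rintro z ⟨n, hn⟩
    by_contra hcon
    have hall : ∀ i, z (i, t) = .abstain := by
      intro i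
      by_contra hi
      exact hcon ⟨i, hi⟩
    simp only [hall, Response.sgn, Finset.sum_const_zero, mul_zero] at hn
    exact absurd hn (not_le.2 (thresholdP_pos hD.pos _ hδ hδ1.le))
  · refine (measure_mono ?_).trans (hD.epochLaw_sgn_le ρ t hρ hσ hδ hδ1)
    rintro z ⟨n, hn⟩
    refine ⟨n, hn.trans ?_⟩
    have hsum := pmf_sum_toReal (ρ t)
    have h0 : 0 ≤ (ρ t .zero).toReal := ENNReal.toReal_nonneg
    have h1 : 0 ≤ (ρ t .one).toReal := ENNReal.toReal_nonneg
    have ha1 : 0 ≤ 1 - (ρ t .abstain).toReal := by linarith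
    have h2 : σ * (((ρ t .one).toReal - (ρ t .zero).toReal) / (1 - (ρ t .abstain).toReal)) ≤ 0 := by
      rw [← mul_div_assoc]
      exact div_nonpos_of_nonpos_of_nonneg (h hρ) ha1
    have h3 := mul_nonpos_of_nonpos_of_nonneg h2
      (Nat.cast_nonneg (α := ℝ) (Nat.count (fun i => z (i, t) ≠ .abstain) n))
    linarith

/-- A Chernoff bound for the number of answers. -/
theorem epochLaw_count_lt_le (ρ : ℝ → PMF Response) (t : ℝ) {φ : ℝ}
    (hφ : (ρ t .abstain).toReal ≤ 1 - φ) {m T : ℕ} {δ : ℝ} (hδ : 0 < δ)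
    (hT : 2 * (m + Real.log (1 / δ)) ≤ φ * T) :
    epochLaw ρ {z | Nat.count (fun i => z (i, t) ≠ .abstain) T < m} ≤ ENNReal.ofReal δ := by
  set μ := Measure.infinitePi fun _ : ℕ => (ρ t).toMeasure with hμ
  refine (epochLaw_column_le ρ t {X | Nat.count (fun i => X i ≠ .abstain) T < m}).trans ?_
  have hcount : ∀ (X : ℕ → Response) (n : ℕ), (Nat.count (fun i => X i ≠ .abstain) n : ℝ) =
      ∑ i ∈ Finset.range n, (X i).answered := by
    intro X n
    induction n with
    | zero => simp
    | succ n ih =>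
      rw [Finset.sum_range_succ, ← ih, Nat.count_succ]
      cases X n <;> simp [Response.answered]
  have hind : iIndepFun (fun (i : ℕ) (X : ℕ → Response) => (X i).answered) μ :=
    iIndepFun_infinitePi (X := fun _ => Response.answered) fun _ => measurable_of_countable _
  have hmeas : ∀ i : ℕ, Measurable fun X : ℕ → Response => (X i).answered := fun i =>
    (measurable_of_countable Response.answered).comp (measurable_pi_apply i)
  -- With abstention probability a, the moment at -1 is 1 - (1 - a)(1 - 1/e) ≤ 1 - φ/2.
  have hmgf : ∀ i : ℕ, mgf (fun X : ℕ → Response => (X i).answered) μ (-1) ≤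
      Real.exp (-(φ / 2)) := by
    intro i
    have := integral_map (μ := μ) (φ := fun X : ℕ → Response => X i)
      (f := fun y => Real.exp (-1 * y.answered)) (Measurable.aemeasurable (by fun_prop))
      (measurable_of_countable _).aestronglyMeasurable
    rw [Measure.infinitePi_map_eval, PMF.integral_eq_sum, Response.sum_eq] at this
    rw [mgf, ← this]
    simp only [Response.answered, smul_eq_mul]
    have hsum := pmf_sum_toReal (ρ t)
    have h0 : 0 ≤ (ρ t .zero).toReal := ENNReal.toReal_nonneg
    have h1 : 0 ≤ (ρ t .one).toReal := ENNReal.toReal_nonneg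
    have he : Real.exp (-1 * 1) ≤ 1 / 2 := by
      rw [mul_one]; linarith [Real.exp_neg_one_lt_d9]
    have h2 := Real.add_one_le_exp (-(φ / 2))
    rw [mul_zero, Real.exp_zero]
    nlinarith
  have hmgf2 : mgf (∑ i ∈ Finset.range T, fun X : ℕ → Response => (X i).answered) μ (-1) ≤
      Real.exp (-(φ / 2) * T) := by
    rw [hind.mgf_sum hmeas]
    calc _ ≤ ∏ i ∈ Finset.range T, Real.exp (-(φ / 2)) :=
          Finset.prod_le_prod (fun i _ => mgf_nonneg) fun i _ => hmgf i
      _ = _ := by rw [Finset.prod_const, Finset.card_range, ← Real.exp_nat_mul, mul_comm]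
  have hmk := measure_le_le_exp_mul_mgf (μ := μ)
    (X := ∑ i ∈ Finset.range T, fun X : ℕ → Response => (X i).answered) (t := -1) (m : ℝ)
    (by norm_num) (by
      have := hind.integrable_exp_mul_sum (t := -1) hmeas (s := Finset.range T) (fun i _ =>
        Integrable.of_bound (C := Real.exp 1) ((hmeas i).const_mul _).exp.aestronglyMeasurable
          (Filter.Eventually.of_forall fun X => by
            rw [Real.norm_eq_abs, Real.abs_exp]
            apply Real.exp_le_exp.2
            have := (X i).answered_mem
            linarith))
      exact this)
  have hreal : μ.real {X | (∑ i ∈ Finset.range T, fun X : ℕ → Response => (X i).answered) X ≤ m}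
      ≤ δ := by
    refine hmk.trans ?_
    calc _ ≤ Real.exp (- -1 * m) * Real.exp (-(φ / 2) * T) := by gcongr
      _ = Real.exp (m - φ * T / 2) := by rw [← Real.exp_add]; congr 1; ring
      _ ≤ Real.exp (-Real.log (1 / δ)) := Real.exp_le_exp.2 (by linarith)
      _ = δ := by rw [one_div, Real.log_inv, neg_neg, Real.exp_log hδ]
  rw [← ENNReal.ofReal_toReal (measure_ne_top μ {X | Nat.count (fun i => X i ≠ .abstain) T < m})]
  refine ENNReal.ofReal_le_ofReal (le_trans ?_ hreal)
  refine ENNReal.toReal_mono (measure_ne_top _ _) (measure_mono fun X hX => ?_)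
  have : (Nat.count (fun i => X i ≠ .abstain) T : ℝ) ≤ m := by
    exact_mod_cast (show Nat.count (fun i => X i ≠ .abstain) T < m from hX).le
  rw [hcount] at this
  simpa using this

/-! ### One epoch -/

/-- The count grows by steps of at most one. This provides a round with exactly m answers, at which
the label test is evaluated. -/
theorem exists_count_eq {p : ℕ → Prop} [DecidablePred p] {m T : ℕ} (hm : 1 ≤ m)
    (h : m ≤ Nat.count p T) : ∃ n, 1 ≤ n ∧ n ≤ T ∧ Nat.count p n = m := by
  classical
  have hex : ∃ n, m ≤ Nat.count p n := ⟨T, h⟩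
  have hspec := Nat.find_spec hex
  have hle : Nat.find hex ≤ T := Nat.find_min' hex h
  obtain ⟨k, hk⟩ : ∃ k, Nat.find hex = k + 1 := by
    refine Nat.exists_eq_succ_of_ne_zero fun h0 => ?_
    rw [h0, Nat.count_zero] at hspec
    omega
  have hlt : Nat.count p k < m := by
    have := Nat.find_min hex (m := k) (by omega)
    omega
  refine ⟨Nat.find hex, by omega, hle, ?_⟩
  rw [hk, Nat.count_succ] at hspec ⊢
  split_ifs at hspec ⊢ <;> omega

/-- The test on labels succeeds within `T` rounds at a point with a sufficient bias. -/
theorem UniformBernstein.epochLaw_no_success_le {D₀ : ℝ} (hD : UniformBernstein D₀)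
    (ρ : ℝ → PMF Response) (t : ℝ) {σ φ b : ℝ} (hσ : |σ| = 1) (hφ0 : 0 < φ)
    (hφ : (ρ t .abstain).toReal ≤ 1 - φ)
    (hb : b * (1 - (ρ t .abstain).toReal) ≤ σ * ((ρ t .one).toReal - (ρ t .zero).toReal))
    {δ : ℝ} (hδ : 0 < δ) (hδ1 : δ < 1) {m T : ℕ} (hm : 1 ≤ m)
    (hmb : 2 * thresholdP D₀ m δ ≤ b * m) (hT : 2 * (m + Real.log (1 / δ)) ≤ φ * T) :
    epochLaw ρ {z | ¬ ∃ n, 1 ≤ n ∧ n ≤ T ∧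
      thresholdP D₀ (signArray (fun i => z (i, t)) n).length δ ≤
        σ * (signArray (fun i => z (i, t)) n).sum} ≤ ENNReal.ofReal (2 * δ) := by
  simp_rw [signArray_length, signArray_sum]
  have h1 := epochLaw_count_lt_le ρ t hφ hδ hT
  -- The opposite sign gives a lower bound: with exactly m answers the signed sum exceeds b·m - p(m,
  -- δ), which is at least p(m, δ) by `hmb`.
  have h2 := hD.epochLaw_sgn_le ρ t (by linarith) (σ := -σ) (by rwa [abs_neg]) hδ hδ1
  rw [two_mul, ENNReal.ofReal_add hδ.le hδ.le]
  refine (measure_mono ?_).trans ((measure_union_le _ _).trans (add_le_add h1 h2))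
  intro z hz
  by_contra hcon
  simp only [Set.mem_union, Set.mem_ofPred_eq, not_or, not_exists, not_lt, not_le] at hcon
  obtain ⟨hc1, hc2⟩ := hcon
  obtain ⟨n, hn1, hnT, hn⟩ := exists_count_eq hm hc1
  refine hz ⟨n, hn1, hnT, ?_⟩
  have h3 := hc2 n
  rw [hn] at h3 ⊢
  set c := ((ρ t .one).toReal - (ρ t .zero).toReal) / (1 - (ρ t .abstain).toReal)
  have hbc : b ≤ σ * c := by
    rw [← mul_div_assoc, le_div_iff₀ (by linarith)]
    exact hb
  have h4 : b * m ≤ σ * c * m := by gcongr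
  linarith

theorem runEpoch_eq_some {D₀ D₁ δ : ℝ} {resp : ℕ → ℝ → Response} {I : ℝ × ℝ} {n : ℕ}
    (hn : 1 ≤ n) (h : (epochTest D₀ D₁ δ resp I n).isSome) :
    ∃ k J, 1 ≤ k ∧ k ≤ n ∧ epochTest D₀ D₁ δ resp I k = some J ∧
      runEpoch D₀ D₁ δ resp I = some (J, 3 * k) := by
  classical
  have hex : ∃ n : ℕ, 1 ≤ n ∧ (epochTest D₀ D₁ δ resp I n).isSome := ⟨n, hn, h⟩
  obtain ⟨J, hJ⟩ := Option.isSome_iff_exists.1 (Nat.find_spec hex).2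
  refine ⟨Nat.find hex, J, (Nat.find_spec hex).1, Nat.find_min' hex ⟨hn, h⟩, hJ, ?_⟩
  rw [runEpoch, dif_pos hex]
  rw [Option.map_eq_some_iff]
  refine ⟨J, ?_, ?_⟩
  · convert hJ
  · congr!

/-- The left and the right end of the interval after an epoch. -/
theorem epochTest_cases {D₀ D₁ δ : ℝ} {resp : ℕ → ℝ → Response} {I J : ℝ × ℝ} {n : ℕ}
    (h : epochTest D₀ D₁ δ resp I n = some J) :
    (J = ((3 * I.1 + I.2) / 4, I.2) ∧
      (CheckSignificantVar D₁ (firstEntries (fun i => (resp i ((3 * I.1 + I.2) / 4)).answered -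
        (resp i ((I.1 + I.2) / 2)).answered) n) δ ∨
      thresholdP D₀ (signArray (fun i => resp i ((3 * I.1 + I.2) / 4)) n).length δ ≤
        -1 * (signArray (fun i => resp i ((3 * I.1 + I.2) / 4)) n).sum)) ∨
    (J = (I.1, (I.1 + 3 * I.2) / 4) ∧
      (CheckSignificantVar D₁ (firstEntries (fun i => (resp i ((I.1 + 3 * I.2) / 4)).answered -
        (resp i ((I.1 + I.2) / 2)).answered) n) δ ∨
      thresholdP D₀ (signArray (fun i => resp i ((I.1 + 3 * I.2) / 4)) n).length δ ≤
        1 * (signArray (fun i => resp i ((I.1 + 3 * I.2) / 4)) n).sum)) := by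
  unfold epochTest at h
  dsimp only at h
  split_ifs at h with h1 h2 h3 h4
  · exact Or.inl ⟨(Option.some_inj.1 h).symm, Or.inl h1⟩
  · exact Or.inr ⟨(Option.some_inj.1 h).symm, Or.inl h2⟩
  · refine Or.inl ⟨(Option.some_inj.1 h).symm, Or.inr ?_⟩
    rw [CheckSignificant, list_sum_map_neg, List.length_map] at h3
    linarith
  · refine Or.inr ⟨(Option.some_inj.1 h).symm, Or.inr ?_⟩
    rw [CheckSignificant] at h4
    linarith

/-- Termination rests on the two label tests alone; the abstention tests can only end the epoch
earlier. -/
theorem epochTest_isSome {D₀ D₁ δ : ℝ} {resp : ℕ → ℝ → Response} {I : ℝ × ℝ} {n : ℕ}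
    (h : thresholdP D₀ (signArray (fun i => resp i ((3 * I.1 + I.2) / 4)) n).length δ ≤
        -1 * (signArray (fun i => resp i ((3 * I.1 + I.2) / 4)) n).sum ∨
      thresholdP D₀ (signArray (fun i => resp i ((I.1 + 3 * I.2) / 4)) n).length δ ≤
        1 * (signArray (fun i => resp i ((I.1 + 3 * I.2) / 4)) n).sum) :
    (epochTest D₀ D₁ δ resp I n).isSome := by
  unfold epochTest
  dsimp only
  split_ifs with h1 h2 h3 h4
  · rfl
  · rfl
  · rfl
  · rfl
  · exfalso
    rcases h with h | h
    · apply h3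
      rw [CheckSignificant, list_sum_map_neg, List.length_map]
      linarith
    · apply h4
      rw [CheckSignificant]
      linarith

/-- The outcome of an epoch that is used in the analysis: one of the two possible intervals, still
containing `θ`, after at most `T` rounds. -/
def EpochGood (D₀ D₁ δ θ : ℝ) (T : ℕ) (I : ℝ × ℝ) (resp : ℕ → ℝ → Response) : Prop :=
  ∃ J q, runEpoch D₀ D₁ δ resp I = some (J, q) ∧
    (J = ((3 * I.1 + I.2) / 4, I.2) ∨ J = (I.1, (I.1 + 3 * I.2) / 4)) ∧
    θ ∈ Set.Icc J.1 J.2 ∧ q ≤ 3 * T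

/-- The epoch stops at the first success, possibly before the round n of `hex` and by another test.
Hence the harmful tests must be excluded at all rounds, and they are harmful only if θ lies in the
part they discard. -/
theorem epochGood_of_success {D₀ D₁ δ θ : ℝ} {T : ℕ} {I : ℝ × ℝ} {resp : ℕ → ℝ → Response}
    (hθ : θ ∈ Set.Icc I.1 I.2)
    (hleft : θ < (3 * I.1 + I.2) / 4 → ∀ n, ¬
      (CheckSignificantVar D₁ (firstEntries (fun i => (resp i ((3 * I.1 + I.2) / 4)).answered -
        (resp i ((I.1 + I.2) / 2)).answered) n) δ ∨
      thresholdP D₀ (signArray (fun i => resp i ((3 * I.1 + I.2) / 4)) n).length δ ≤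
        -1 * (signArray (fun i => resp i ((3 * I.1 + I.2) / 4)) n).sum))
    (hright : (I.1 + 3 * I.2) / 4 < θ → ∀ n, ¬
      (CheckSignificantVar D₁ (firstEntries (fun i => (resp i ((I.1 + 3 * I.2) / 4)).answered -
        (resp i ((I.1 + I.2) / 2)).answered) n) δ ∨
      thresholdP D₀ (signArray (fun i => resp i ((I.1 + 3 * I.2) / 4)) n).length δ ≤
        1 * (signArray (fun i => resp i ((I.1 + 3 * I.2) / 4)) n).sum))
    (hex : ∃ n, 1 ≤ n ∧ n ≤ T ∧
      (thresholdP D₀ (signArray (fun i => resp i ((3 * I.1 + I.2) / 4)) n).length δ ≤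
        -1 * (signArray (fun i => resp i ((3 * I.1 + I.2) / 4)) n).sum ∨
      thresholdP D₀ (signArray (fun i => resp i ((I.1 + 3 * I.2) / 4)) n).length δ ≤
        1 * (signArray (fun i => resp i ((I.1 + 3 * I.2) / 4)) n).sum)) :
    EpochGood D₀ D₁ δ θ T I resp := by
  obtain ⟨n, hn1, hnT, hn⟩ := hex
  obtain ⟨k, J, -, hkn, hJ, hrun⟩ := runEpoch_eq_some hn1 (epochTest_isSome (D₁ := D₁) hn)
  refine ⟨J, 3 * k, hrun, ?_, ?_, by omega⟩
  · rcases epochTest_cases hJ with h | h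
    · exact Or.inl h.1
    · exact Or.inr h.1
  · rcases epochTest_cases hJ with ⟨rfl, h⟩ | ⟨rfl, h⟩
    · refine ⟨?_, hθ.2⟩
      by_contra! hcon
      exact hleft hcon k h
    · refine ⟨hθ.1, ?_⟩
      by_contra! hcon
      exact hright hcon k h

/-! ### Bias of the labels and success probability of one epoch -/

section

variable {m : ℕ} {P : Labeler m} {g : (Fin m → ℝ) → ℝ} {u : Fin m → ℝ}

theorem wrong_le_of_noise {x : Point m} {η : ℝ} (ha : abstainProb P x ≠ 1)
    (h : noiseProb P g x ≤ 1 / 2 * (1 - η)) :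
    (P x (wrongLabel g x)).toReal ≤ 1 / 2 * (1 - η) * (1 - (P x .abstain).toReal) := by
  have hsum := pmf_sum_toReal (P x)
  have h0 : 0 ≤ (P x .zero).toReal := ENNReal.toReal_nonneg
  have h1 : 0 ≤ (P x .one).toReal := ENNReal.toReal_nonneg
  have ha1 : 0 < 1 - (P x .abstain).toReal :=
    lt_of_le_of_ne (by linarith) fun h => ha (by rw [abstainProb]; linarith)
  rw [noiseProb, abstainProb, div_le_iff₀ ha1] at h
  exact h

/-- Used with η = 0 to show that the harmful label test has no drift in its favour, and with η =
C·r^β for termination. In the companion statement t = g u is included, since the true label on the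
boundary is 0. -/
theorem sgn_mean_of_lt {t η : ℝ} (hgt : g u < t) (ha : abstainProb P (u, t) ≠ 1)
    (h : noiseProb P g (u, t) ≤ 1 / 2 * (1 - η)) :
    η * (1 - (P (u, t) .abstain).toReal) ≤
      1 * ((P (u, t) .one).toReal - (P (u, t) .zero).toReal) := by
  have hw := wrong_le_of_noise ha h
  have hl : wrongLabel g (u, t) = .zero := if_pos hgt
  rw [hl] at hw
  have hsum := pmf_sum_toReal (P (u, t))
  nlinarith

theorem sgn_mean_of_le {t η : ℝ} (hgt : t ≤ g u) (ha : abstainProb P (u, t) ≠ 1)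
    (h : noiseProb P g (u, t) ≤ 1 / 2 * (1 - η)) :
    η * (1 - (P (u, t) .abstain).toReal) ≤
      -1 * ((P (u, t) .one).toReal - (P (u, t) .zero).toReal) := by
  have hw := wrong_le_of_noise ha h
  have hl : wrongLabel g (u, t) = .one := if_neg (not_lt.2 hgt)
  rw [hl] at hw
  have hsum := pmf_sum_toReal (P (u, t))
  nlinarith

theorem BoundedLabeler.bias_le {C β r t : ℝ} {f : ℝ → ℝ} (hB : BoundedLabeler P g C β f)
    (hC : 0 < C) (hβ : 0 ≤ β) (hf : MonotoneOn f (Set.Icc 0 1)) (hu : u ∈ cube m)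
    (ht : t ∈ Set.Icc (0 : ℝ) 1) (hg : g u ∈ Set.Icc (0 : ℝ) 1) (hr : 0 < r)
    (hrt : r ≤ |t - g u|) (hfr : 0 < f r) :
    (P (u, t) .abstain).toReal ≤ 1 - f r ∧ abstainProb P (u, t) ≠ 1 ∧
      noiseProb P g (u, t) ≤ 1 / 2 * (1 - C * r ^ β) := by
  have h1 : |t - g u| ≤ 1 := abs_le.2 ⟨by linarith [ht.1, hg.2], by linarith [ht.2, hg.1]⟩
  have h2 : f r ≤ f |t - g u| :=
    hf ⟨hr.le, hrt.trans h1⟩ ⟨abs_nonneg _, h1⟩ hrt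
  have h3 := hB.abstention u hu t ht
  have h4 : abstainProb P (u, t) ≤ 1 - f r := by linarith
  have h5 : abstainProb P (u, t) ≠ 1 := by intro h; linarith
  refine ⟨h4, h5, (hB.noise u hu t ht h5).trans ?_⟩
  have : r ^ β ≤ |t - g u| ^ β := Real.rpow_le_rpow hr.le hrt hβ
  nlinarith

/-- An epoch succeeds with high probability. -/
theorem epochLaw_not_epochGood_le {C β r D₀ D₁ δ : ℝ} {f : ℝ → ℝ} {I : ℝ × ℝ} {k T : ℕ}
    (hD₀ : UniformBernstein D₀) (hD₁ : UniformEmpiricalBernstein D₁)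
    (hM : MonotoneLabeler P g) (hB : BoundedLabeler P g C β f)
    (hC : 0 < C) (hβ : 0 ≤ β) (hf : MonotoneOn f (Set.Icc 0 1)) (hu : u ∈ cube m)
    (hδ : 0 < δ) (hδ1 : δ < 1) (hI0 : 0 ≤ I.1) (hI1 : I.2 ≤ 1) (hg : g u ∈ Set.Icc I.1 I.2)
    (hr : 0 < r) (hrI : 4 * r ≤ I.2 - I.1) (hfr : 0 < f r) (hk : 1 ≤ k)
    (hkb : 2 * thresholdP D₀ k δ ≤ C * r ^ β * k) (hT : 2 * (k + Real.log (1 / δ)) ≤ f r * T) :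
    epochLaw (fun t => P (u, t)) {z | ¬ EpochGood D₀ D₁ δ (g u) T I fun i t => z (i, t)} ≤
      ENNReal.ofReal (4 * δ) := by
  obtain ⟨hg1, hg2⟩ := hg
  have hg01 : g u ∈ Set.Icc (0 : ℝ) 1 := ⟨by linarith, by linarith⟩
  set ρ : ℝ → PMF Response := fun t => P (u, t) with hρ
  set U := (3 * I.1 + I.2) / 4 with hU
  set M := (I.1 + I.2) / 2 with hMid
  set V := (I.1 + 3 * I.2) / 4 with hV
  have hU01 : U ∈ Set.Icc (0 : ℝ) 1 := ⟨by linarith, by linarith⟩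
  have hM01 : M ∈ Set.Icc (0 : ℝ) 1 := ⟨by linarith, by linarith⟩
  have hV01 : V ∈ Set.Icc (0 : ℝ) 1 := ⟨by linarith, by linarith⟩
  have hhalf : (1 : ℝ) / 2 = 1 / 2 * (1 - 0) := by norm_num
  -- For g u ≤ M the point V is at least a quarter of the interval, hence at least r, above the
  -- boundary.
  have htermV : g u ≤ M → epochLaw ρ {z | ¬ ∃ n, 1 ≤ n ∧ n ≤ T ∧
      thresholdP D₀ (signArray (fun i => z (i, V)) n).length δ ≤
        1 * (signArray (fun i => z (i, V)) n).sum} ≤ ENNReal.ofReal (2 * δ) := by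
    intro h
    obtain ⟨h1, h2, h3⟩ := hB.bias_le hC hβ hf hu hV01 hg01 hr
      (by rw [abs_of_nonneg (by linarith)]; linarith) hfr
    exact hD₀.epochLaw_no_success_le ρ V (by simp) hfr h1
      (sgn_mean_of_lt (by linarith) h2 h3) hδ hδ1 hk hkb hT
  have htermU : M ≤ g u → epochLaw ρ {z | ¬ ∃ n, 1 ≤ n ∧ n ≤ T ∧
      thresholdP D₀ (signArray (fun i => z (i, U)) n).length δ ≤
        -1 * (signArray (fun i => z (i, U)) n).sum} ≤ ENNReal.ofReal (2 * δ) := by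
    intro h
    obtain ⟨h1, h2, h3⟩ := hB.bias_le hC hβ hf hu hU01 hg01 hr
      (by rw [abs_of_nonpos (by linarith)]; linarith) hfr
    exact hD₀.epochLaw_no_success_le ρ U (by simp) hfr h1
      (sgn_mean_of_le (by linarith) h2 h3) hδ hδ1 hk hkb hT
  -- The budget: δ for each of two tests that must never succeed, and 2δ for termination, where both
  -- the number of answers and the sum of the labels may deviate.
  have h4δ : ENNReal.ofReal (4 * δ) =
      (ENNReal.ofReal δ + ENNReal.ofReal δ) + ENNReal.ofReal (2 * δ) := by
    rw [← ENNReal.ofReal_add hδ.le hδ.le, ← ENNReal.ofReal_add (by linarith) (by linarith)]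
    congr 1
    ring
  have h2δ : ENNReal.ofReal (2 * δ) ≤ ENNReal.ofReal (4 * δ) :=
    ENNReal.ofReal_le_ofReal (by linarith)
  -- If g u < U, only the tests at U can discard it; U is nearer to it than M, which gives the sign
  -- needed for the abstention test.
  rcases lt_or_ge (g u) U with hgU | hgU
  · have hw1 := hD₁.epochLaw_test_le ρ (s := U) (t := M) (by intro h; linarith)
      (hM.abstention u hu M hM01 U hU01 (by
        rw [abs_of_nonneg (by linarith), abs_of_nonneg (by linarith)]; linarith)) hδ hδ1
    have hw3 := hD₀.epochLaw_test_le ρ U (σ := -1) (by simp) (fun ha => by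
      have := sgn_mean_of_lt (η := 0) hgU ha ((hM.noise u hu U hU01 ha).trans_eq hhalf)
      simp only [hρ]
      linarith) hδ hδ1
    rw [h4δ]
    refine (measure_mono ?_).trans ((measure_union_le _ _).trans (add_le_add
      ((measure_union_le _ _).trans (add_le_add hw1 hw3)) (htermV (by linarith))))
    intro z hz
    by_contra hcon
    simp only [Set.mem_union, Set.mem_ofPred_eq, not_or, not_exists] at hcon
    obtain ⟨⟨h1, h3⟩, h5⟩ := hcon
    obtain ⟨n, hn1, hnT, hn⟩ := not_forall_not.1 h5
    refine hz (epochGood_of_success ⟨hg1, hg2⟩ (fun _ n h => ?_) (fun h => ?_)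
      ⟨n, hn1, hnT, Or.inr hn⟩)
    · exact h.elim (h1 n) (h3 n)
    · exfalso; linarith
  · rcases lt_or_ge V (g u) with hgV | hgV
    · have hw1 := hD₁.epochLaw_test_le ρ (s := V) (t := M) (by intro h; linarith)
        (hM.abstention u hu M hM01 V hV01 (by
          rw [abs_of_nonpos (by linarith), abs_of_nonpos (by linarith)]; linarith)) hδ hδ1
      have hw3 := hD₀.epochLaw_test_le ρ V (σ := 1) (by simp) (fun ha => by
        have := sgn_mean_of_le (η := 0) hgV.le ha ((hM.noise u hu V hV01 ha).trans_eq hhalf)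
        simp only [hρ]
        linarith) hδ hδ1
      rw [h4δ]
      refine (measure_mono ?_).trans ((measure_union_le _ _).trans (add_le_add
        ((measure_union_le _ _).trans (add_le_add hw1 hw3)) (htermU (by linarith))))
      intro z hz
      by_contra hcon
      simp only [Set.mem_union, Set.mem_ofPred_eq, not_or, not_exists] at hcon
      obtain ⟨⟨h1, h3⟩, h5⟩ := hcon
      obtain ⟨n, hn1, hnT, hn⟩ := not_forall_not.1 h5
      refine hz (epochGood_of_success ⟨hg1, hg2⟩ (fun h => ?_) (fun _ n h => ?_)
        ⟨n, hn1, hnT, Or.inl hn⟩)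
      · exfalso; linarith
      · exact h.elim (h1 n) (h3 n)
    -- Here g u lies in [U, V], so neither cut loses it and only termination is at stake.
    · refine le_trans ?_ h2δ
      rcases le_total (g u) M with hgM | hgM
      · refine (measure_mono ?_).trans (htermV hgM)
        rintro z hz ⟨n, hn1, hnT, hn⟩
        exact hz (epochGood_of_success ⟨hg1, hg2⟩ (fun h => absurd h (not_lt.2 hgU))
          (fun h => absurd h (not_lt.2 hgV)) ⟨n, hn1, hnT, Or.inr hn⟩)
      · refine (measure_mono ?_).trans (htermU hgM)
        rintro z hz ⟨n, hn1, hnT, hn⟩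
        exact hz (epochGood_of_success ⟨hg1, hg2⟩ (fun h => absurd h (not_lt.2 hgU))
          (fun h => absurd h (not_lt.2 hgV)) ⟨n, hn1, hnT, Or.inl hn⟩)

end

/-! ### All epochs on a line -/

/-- The intervals that can occur after `k` epochs. -/
def intervals : ℕ → Finset (ℝ × ℝ)
  | 0 => {(0, 1)}
  | k + 1 => (intervals k).image (fun I => ((3 * I.1 + I.2) / 4, I.2)) ∪
      (intervals k).image fun I => (I.1, (I.1 + 3 * I.2) / 4)

/-- A test reads finitely many responses. It therefore factors through a finite product of finite
discrete spaces, from which measurability follows. -/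
theorem epochTest_congr {D₀ D₁ δ : ℝ} {resp resp' : ℕ → ℝ → Response} {I : ℝ × ℝ} {n : ℕ}
    (h : ∀ i < n, ∀ x ∈ ({(3 * I.1 + I.2) / 4, (I.1 + I.2) / 2, (I.1 + 3 * I.2) / 4} : Finset ℝ),
      resp i x = resp' i x) :
    epochTest D₀ D₁ δ resp I n = epochTest D₀ D₁ δ resp' I n := by
  have hx : ∀ x ∈ ({((3 * I.1 + I.2) / 4), ((I.1 + I.2) / 2), ((I.1 + 3 * I.2) / 4)} : Finset ℝ), ∀ i ∈ List.range n, resp i x = resp' i x :=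
    fun x hx i hi => h i (List.mem_range.1 hi) x hx
  have hA : ∀ x ∈ ({((3 * I.1 + I.2) / 4), ((I.1 + I.2) / 2), ((I.1 + 3 * I.2) / 4)} : Finset ℝ),
      firstEntries (fun i => (resp i x).answered - (resp i ((I.1 + I.2) / 2)).answered) n =
        firstEntries (fun i => (resp' i x).answered - (resp' i ((I.1 + I.2) / 2)).answered) n :=
    fun x hx' => List.map_congr_left fun i hi => by rw [hx x hx' i hi, hx ((I.1 + I.2) / 2) (by simp) i hi]
  have hS : ∀ x ∈ ({((3 * I.1 + I.2) / 4), ((I.1 + I.2) / 2), ((I.1 + 3 * I.2) / 4)} : Finset ℝ),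
      signArray (fun i => resp i x) n = signArray (fun i => resp' i x) n :=
    fun x hx' => List.filterMap_congr fun i hi => congrArg Response.sign? (hx x hx' i hi)
  classical
  unfold epochTest
  dsimp only
  refine if_congr ?_ rfl (if_congr ?_ rfl (if_congr ?_ rfl (if_congr ?_ rfl rfl)))
  · rw [hA ((3 * I.1 + I.2) / 4) (by simp)]
  · rw [hA ((I.1 + 3 * I.2) / 4) (by simp)]
  · rw [hS ((3 * I.1 + I.2) / 4) (by simp)]
  · rw [hS ((I.1 + 3 * I.2) / 4) (by simp)]

theorem measurableSet_epochTest {Ω : Type*} [MeasurableSpace Ω] {resp : Ω → ℕ → ℝ → Response}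
    (h : ∀ i t, Measurable fun ω => resp ω i t) (D₀ D₁ δ : ℝ) (I : ℝ × ℝ) (n : ℕ)
    (S : Set (Option (ℝ × ℝ))) :
    MeasurableSet {ω | epochTest D₀ D₁ δ (resp ω) I n ∈ S} := by
  classical
  let F : Finset ℝ := {(3 * I.1 + I.2) / 4, (I.1 + I.2) / 2, (I.1 + 3 * I.2) / 4}
  let R : Ω → (Fin n × F → Response) := fun ω p => resp ω p.1 p.2
  let ext : (Fin n × F → Response) → ℕ → ℝ → Response := fun r i x =>
    if h : i < n ∧ x ∈ F then r (⟨i, h.1⟩, ⟨x, h.2⟩) else .zero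
  have hR : Measurable R := measurable_pi_lambda _ fun p => h _ _
  have heq : {ω | epochTest D₀ D₁ δ (resp ω) I n ∈ S} =
      R ⁻¹' {r | epochTest D₀ D₁ δ (ext r) I n ∈ S} := by
    ext ω
    have : epochTest D₀ D₁ δ (resp ω) I n = epochTest D₀ D₁ δ (ext (R ω)) I n :=
      epochTest_congr fun i hi x hx => by
        have : i < n ∧ x ∈ F := ⟨hi, hx⟩
        simp [ext, R, this]
    simp only [Set.mem_ofPred_eq, Set.mem_preimage, this]
  rw [heq]
  exact hR (Set.to_countable _).measurableSet

theorem runEpoch_eq_some_iff {D₀ D₁ δ : ℝ} {resp : ℕ → ℝ → Response} {I J : ℝ × ℝ} :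
    (∃ q, runEpoch D₀ D₁ δ resp I = some (J, q)) ↔
      ∃ n, 1 ≤ n ∧ epochTest D₀ D₁ δ resp I n = some J ∧
        ∀ k < n, 1 ≤ k → epochTest D₀ D₁ δ resp I k = none := by
  classical
  constructor
  · rintro ⟨q, hq⟩
    rw [runEpoch] at hq
    split_ifs at hq with hex
    rw [Option.map_eq_some_iff] at hq
    obtain ⟨J', h1, h2⟩ := hq
    have hJ : J' = J := (Prod.ext_iff.1 h2).1
    subst hJ
    refine ⟨_, (Nat.find_spec hex).1, ?_, fun k hk hk1 => ?_⟩
    · convert h1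
    · by_contra hcon
      exact Nat.find_min hex hk ⟨hk1, Option.isSome_iff_ne_none.2 hcon⟩
  · rintro ⟨n, hn, hJ, hmin⟩
    obtain ⟨k, J', hk1, hkn, hk, hrun⟩ := runEpoch_eq_some hn (Option.isSome_iff_exists.2 ⟨J, hJ⟩)
    have hkn' : k = n := by
      by_contra hne
      rw [hmin k (by omega) hk1] at hk
      exact absurd hk (by simp)
    subst hkn'
    rw [hJ] at hk
    exact ⟨_, by rw [hrun, Option.some_inj.1 hk]⟩

theorem measurableSet_runEpoch {Ω : Type*} [MeasurableSpace Ω] {resp : Ω → ℕ → ℝ → Response}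
    (h : ∀ i t, Measurable fun ω => resp ω i t) (D₀ D₁ δ : ℝ) (I J : ℝ × ℝ) :
    MeasurableSet {ω | ∃ q, runEpoch D₀ D₁ δ (resp ω) I = some (J, q)} := by
  simp_rw [runEpoch_eq_some_iff]
  have : {ω | ∃ n, 1 ≤ n ∧ epochTest D₀ D₁ δ (resp ω) I n = some J ∧
        ∀ k < n, 1 ≤ k → epochTest D₀ D₁ δ (resp ω) I k = none} =
      ⋃ n, ⋃ (_ : 1 ≤ n), {ω | epochTest D₀ D₁ δ (resp ω) I n ∈ ({some J} : Set _)} ∩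
        ⋂ k, ⋂ (_ : k < n), ⋂ (_ : 1 ≤ k),
          {ω | epochTest D₀ D₁ δ (resp ω) I k ∈ ({none} : Set _)} := by
    ext ω; simp [and_left_comm]
  rw [this]
  refine MeasurableSet.iUnion fun n => MeasurableSet.iUnion fun _ =>
    (measurableSet_epochTest h D₀ D₁ δ I n _).inter ?_
  exact MeasurableSet.iInter fun k => MeasurableSet.iInter fun _ => MeasurableSet.iInter fun _ =>
    measurableSet_epochTest h D₀ D₁ δ I k _

theorem runEpochs_succ_eq_some_iff {D₀ D₁ δ : ℝ} {resp : ℕ → ℕ → ℝ → Response} {k : ℕ}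
    {J : ℝ × ℝ} {q : ℕ} :
    runEpochs D₀ D₁ δ resp (k + 1) = some (J, q) ↔ ∃ I q₁ q₂,
      runEpochs D₀ D₁ δ resp k = some (I, q₁) ∧ runEpoch D₀ D₁ δ (resp k) I = some (J, q₂) ∧
        q = q₁ + q₂ := by
  simp only [runEpochs, Option.bind_eq_some_iff, Option.map_eq_some_iff, Prod.exists,
    Prod.mk.injEq]
  constructor
  · rintro ⟨a, b, q₁, h1, c, d, q₂, h2, rfl, rfl⟩
    exact ⟨a, b, q₁, q₂, h1, h2, rfl⟩
  · rintro ⟨a, b, q₁, q₂, h1, h2, rfl⟩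
    exact ⟨a, b, q₁, h1, J.1, J.2, q₂, h2, rfl, rfl⟩

theorem mem_intervals_of_runEpochs {D₀ D₁ δ : ℝ} {resp : ℕ → ℕ → ℝ → Response} :
    ∀ {k : ℕ} {I : ℝ × ℝ} {q : ℕ}, runEpochs D₀ D₁ δ resp k = some (I, q) → I ∈ intervals k
  | 0, I, q, h => by
    simp only [runEpochs, Option.some_inj, Prod.mk.injEq] at h
    simp [intervals, ← h.1]
  | k + 1, J, q, h => by
    obtain ⟨I, q₁, q₂, h1, h2, -⟩ := runEpochs_succ_eq_some_iff.1 h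
    have hI := mem_intervals_of_runEpochs h1
    obtain ⟨n, -, hn, -⟩ := runEpoch_eq_some_iff.1 ⟨q₂, h2⟩
    rw [intervals, Finset.mem_union, Finset.mem_image, Finset.mem_image]
    rcases epochTest_cases hn with ⟨rfl, -⟩ | ⟨rfl, -⟩
    · exact Or.inl ⟨I, hI, rfl⟩
    · exact Or.inr ⟨I, hI, rfl⟩

/-- The σ-algebra on Ω is left arbitrary, and only the epochs before k need to be measurable. It is
later taken to be generated by the responses of those epochs, which yields independence from epoch
k. -/
theorem measurableSet_runEpochs {Ω : Type*} [MeasurableSpace Ω] {resp : Ω → ℕ → ℕ → ℝ → Response}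
    (D₀ D₁ δ : ℝ) : ∀ (k : ℕ) (_ : ∀ j < k, ∀ i t, Measurable fun ω => resp ω j i t) (J : ℝ × ℝ),
      MeasurableSet {ω | ∃ q, runEpochs D₀ D₁ δ (resp ω) k = some (J, q)}
  | 0, _, J => by simp [runEpochs]
  | k + 1, h, J => by
    have : {ω | ∃ q, runEpochs D₀ D₁ δ (resp ω) (k + 1) = some (J, q)} =
        ⋃ I ∈ intervals k, {ω | ∃ q, runEpochs D₀ D₁ δ (resp ω) k = some (I, q)} ∩
          {ω | ∃ q, runEpoch D₀ D₁ δ (resp ω k) I = some (J, q)} := by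
      ext ω
      simp only [Set.mem_ofPred_eq, Set.mem_iUnion, Set.mem_inter_iff, exists_prop]
      constructor
      · rintro ⟨q, hq⟩
        obtain ⟨I, q₁, q₂, h1, h2, -⟩ := runEpochs_succ_eq_some_iff.1 hq
        exact ⟨I, mem_intervals_of_runEpochs h1, ⟨q₁, h1⟩, q₂, h2⟩
      · rintro ⟨I, -, ⟨q₁, h1⟩, q₂, h2⟩
        exact ⟨q₁ + q₂, runEpochs_succ_eq_some_iff.2 ⟨I, q₁, q₂, h1, h2, rfl⟩⟩
    rw [this]
    refine Finset.measurableSet_biUnion _ fun I _ => ?_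
    exact (measurableSet_runEpochs D₀ D₁ δ k (fun j hj => h j (by omega)) I).inter
      (measurableSet_runEpoch (h k (by omega)) D₀ D₁ δ I J)

/-! ### Independence of the epochs and induction over them -/

section

variable {m : ℕ} (P : Labeler m) (u : Fin m → ℝ)

instance : IsProbabilityMeasure (responseLaw P) := by
  unfold responseLaw; infer_instance

/-- The responses on the line of `u` in epoch `k`. -/
def epochTable (k : ℕ) (ω : ResponseTable m) : ℕ × ℝ → Response :=
  fun p => ω (k, p.1, (u, p.2))

theorem map_epochTable_responseLaw (k : ℕ) :
    (responseLaw P).map (epochTable u k) = epochLaw fun t => P (u, t) :=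
  Measure.map_infinitePi_infinitePi_of_inj (f := fun p : ℕ × ℝ => (k, p.1, (u, p.2)))
    (fun p q h => by
      simp only [Prod.mk.injEq, true_and] at h
      exact Prod.ext h.1 h.2)

/-- An event of the first `k` epochs is independent of an event of epoch `k`. -/
theorem responseLaw_inter_le {k : ℕ} {A : Set (ResponseTable m)}
    (hA : MeasurableSet[⨆ i ∈ {i : ℕ × ℕ × Point m | i.1 < k},
      MeasurableSpace.comap (fun ω : ResponseTable m => ω i) inferInstance] A)
    (B : Set (ℕ × ℝ → Response)) :
    responseLaw P (A ∩ epochTable u k ⁻¹' B) ≤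
      responseLaw P A * epochLaw (fun t => P (u, t)) B := by
  have hind : iIndepFun (fun (i : ℕ × ℕ × Point m) (ω : ResponseTable m) => ω i)
      (responseLaw P) := iIndepFun_infinitePi (X := fun _ y => y) fun _ => measurable_id
  have hdisj : Disjoint {i : ℕ × ℕ × Point m | i.1 < k} {i | i.1 = k} := by
    rw [Set.disjoint_left]
    intro i h1 h2
    exact absurd (show i.1 = k from h2) (ne_of_lt h1)
  have h := indep_iSup_of_disjoint (fun i => (measurable_pi_apply i).comap_le) hind.iIndep hdisj
  -- No measurability of B is assumed; its measurable hull has the same measure.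
  set B' := toMeasurable (epochLaw fun t => P (u, t)) B with hB'
  have hB'm : MeasurableSet B' := measurableSet_toMeasurable _ _
  have hm : Measurable[⨆ i ∈ {i : ℕ × ℕ × Point m | i.1 = k},
      MeasurableSpace.comap (fun ω : ResponseTable m => ω i) inferInstance] (epochTable u k) := by
    refine @measurable_pi_lambda _ _ _ (_) _ _ fun p => ?_
    refine Measurable.mono (comap_measurable
      (fun ω : ResponseTable m => ω (k, p.1, (u, p.2)))) ?_ le_rfl
    exact le_biSup (fun i : ℕ × ℕ × Point m =>
      MeasurableSpace.comap (fun ω : ResponseTable m => ω i) inferInstance)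
      (show ((k, p.1, (u, p.2)) : ℕ × ℕ × Point m) ∈ {i : ℕ × ℕ × Point m | i.1 = k} from rfl)
  have hm' : Measurable (epochTable u k : ResponseTable m → _) :=
    measurable_pi_lambda _ fun p => measurable_pi_apply _
  calc responseLaw P (A ∩ epochTable u k ⁻¹' B) ≤ responseLaw P (A ∩ epochTable u k ⁻¹' B') :=
        measure_mono (Set.inter_subset_inter_right _
          (Set.preimage_mono (subset_toMeasurable _ _)))
    _ = responseLaw P A * responseLaw P (epochTable u k ⁻¹' B') :=
        (Indep_iff _ _ _).1 h _ _ hA (hm hB'm)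
    _ = responseLaw P A * epochLaw (fun t => P (u, t)) B := by
        rw [← Measure.map_apply hm' hB'm, map_epochTable_responseLaw, hB', measure_toMeasurable]

/-- The responses on the line of `u`, as they are read by the algorithm for thresholds. -/
def lineResponses (ω : ResponseTable m) (k i : ℕ) (t : ℝ) : Response := ω (k, i, (u, t))

/-- The state after `k` epochs that is used in the analysis. -/
def RunGood (D₀ D₁ δ θ : ℝ) (T k : ℕ) (resp : ℕ → ℕ → ℝ → Response) : Prop :=
  ∃ I q, runEpochs D₀ D₁ δ resp k = some (I, q) ∧ 0 ≤ I.1 ∧ I.2 ≤ 1 ∧ I.2 - I.1 = (3 / 4) ^ k ∧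
    θ ∈ Set.Icc I.1 I.2 ∧ q ≤ 3 * T * k

variable {P u}

theorem runGood_succ {D₀ D₁ δ θ : ℝ} {T k : ℕ} {resp : ℕ → ℕ → ℝ → Response} {I : ℝ × ℝ} {q : ℕ}
    (h : runEpochs D₀ D₁ δ resp k = some (I, q)) (h0 : 0 ≤ I.1) (h1 : I.2 ≤ 1)
    (hlen : I.2 - I.1 = (3 / 4) ^ k) (hq : q ≤ 3 * T * k)
    (he : EpochGood D₀ D₁ δ θ T I (resp k)) : RunGood D₀ D₁ δ θ T (k + 1) resp := by
  obtain ⟨J, q', hrun, hJ, hθ, hq'⟩ := he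
  have hpos : (0 : ℝ) < (3 / 4) ^ k := by positivity
  refine ⟨J, q + q', runEpochs_succ_eq_some_iff.2 ⟨I, q, q', h, hrun, rfl⟩, ?_, ?_, ?_, hθ, ?_⟩
  · rcases hJ with rfl | rfl
    · dsimp only; linarith
    · exact h0
  · rcases hJ with rfl | rfl
    · exact h1
    · dsimp only; linarith
  · rw [pow_succ, ← hlen]
    rcases hJ with rfl | rfl <;> dsimp only <;> ring
  · rw [Nat.mul_succ]; omega

/-- A first failure in epoch k is split according to the interval I reached before it. The events `A
I` are disjoint and independent of the responses in epoch k, so the bound for a fixed interval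
carries over to the random one without a factor for the number of intervals. -/
theorem responseLaw_not_runGood_le {D₀ D₁ δ θ : ℝ} {T N : ℕ} (hδ : 0 ≤ δ)
    (hθ : θ ∈ Set.Icc (0 : ℝ) 1)
    (hepoch : ∀ k < N, ∀ I : ℝ × ℝ, 0 ≤ I.1 → I.2 ≤ 1 → I.2 - I.1 = (3 / 4) ^ k →
      θ ∈ Set.Icc I.1 I.2 → epochLaw (fun t => P (u, t))
        {z | ¬ EpochGood D₀ D₁ δ θ T I fun i t => z (i, t)} ≤ ENNReal.ofReal (4 * δ)) :
    ∀ k ≤ N, responseLaw P {ω | ¬ RunGood D₀ D₁ δ θ T k (lineResponses u ω)} ≤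
      ENNReal.ofReal (k * (4 * δ)) := by
  intro k
  induction k with
  | zero =>
    intro _
    have : {ω : ResponseTable m | ¬ RunGood D₀ D₁ δ θ T 0 (lineResponses u ω)} = ∅ := by
      ext ω
      simp only [Set.mem_ofPred_eq, Set.mem_empty_iff_false, iff_false, not_not]
      exact ⟨(0, 1), 0, rfl, le_rfl, le_rfl, by norm_num, hθ, by simp⟩
    rw [this]
    simp
  | succ k ih =>
    intro hk
    have ih' := ih (by omega)
    let A : ℝ × ℝ → Set (ResponseTable m) := fun I =>
      {ω | ∃ q, runEpochs D₀ D₁ δ (lineResponses u ω) k = some (I, q)}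
    let V : Set (ℝ × ℝ) := {I | 0 ≤ I.1 ∧ I.2 ≤ 1 ∧ I.2 - I.1 = (3 / 4) ^ k ∧ θ ∈ Set.Icc I.1 I.2}
    -- Membership in `V` is part of the event, so that it is empty for those intervals to which
    -- `hepoch` does not apply.
    let B : ℝ × ℝ → Set (ℕ × ℝ → Response) := fun I =>
      {z | I ∈ V ∧ ¬ EpochGood D₀ D₁ δ θ T I fun i t => z (i, t)}
    have hB : ∀ I, epochLaw (fun t => P (u, t)) (B I) ≤ ENNReal.ofReal (4 * δ) := by
      intro I
      by_cases hI : I ∈ V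
      · exact (measure_mono fun z hz => hz.2).trans
          (hepoch k (by omega) I hI.1 hI.2.1 hI.2.2.1 hI.2.2.2)
      · have : B I = ∅ := by
          ext z; simp [B, hI]
        rw [this]
        simp
    have hle : (⨆ i ∈ {i : ℕ × ℕ × Point m | i.1 < k},
        MeasurableSpace.comap (fun ω : ResponseTable m => ω i) inferInstance) ≤
          (inferInstance : MeasurableSpace (ResponseTable m)) :=
      iSup₂_le fun i _ => (measurable_pi_apply i).comap_le
    have hA : ∀ I, MeasurableSet[⨆ i ∈ {i : ℕ × ℕ × Point m | i.1 < k},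
        MeasurableSpace.comap (fun ω : ResponseTable m => ω i) inferInstance] (A I) := by
      intro I
      refine @measurableSet_runEpochs _ (_) _ D₀ D₁ δ k (fun j hj i t => ?_) I
      refine Measurable.mono (comap_measurable
        (fun ω : ResponseTable m => ω (j, i, (u, t)))) ?_ le_rfl
      exact le_biSup (fun i : ℕ × ℕ × Point m =>
        MeasurableSpace.comap (fun ω : ResponseTable m => ω i) inferInstance)
        (show ((j, i, (u, t)) : ℕ × ℕ × Point m) ∈ {i : ℕ × ℕ × Point m | i.1 < k} from hj)
    have hdisj : Set.PairwiseDisjoint (intervals k : Set (ℝ × ℝ)) A := by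
      intro I _ J _ hIJ
      refine Set.disjoint_left.2 ?_
      rintro ω ⟨q, hq⟩ ⟨q', hq'⟩
      rw [hq, Option.some_inj] at hq'
      exact hIJ (Prod.ext_iff.1 hq').1
    have hnew : responseLaw P (⋃ I ∈ intervals k, A I ∩ epochTable u k ⁻¹' B I) ≤
        ENNReal.ofReal (4 * δ) := by
      calc responseLaw P (⋃ I ∈ intervals k, A I ∩ epochTable u k ⁻¹' B I)
          ≤ ∑ I ∈ intervals k, responseLaw P (A I ∩ epochTable u k ⁻¹' B I) :=
            measure_biUnion_finset_le _ _
        _ ≤ ∑ I ∈ intervals k, responseLaw P (A I) * ENNReal.ofReal (4 * δ) :=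
            Finset.sum_le_sum fun I _ => (responseLaw_inter_le P u (hA I) (B I)).trans
              (by gcongr; exact hB I)
        _ = responseLaw P (⋃ I ∈ intervals k, A I) * ENNReal.ofReal (4 * δ) := by
            rw [← Finset.sum_mul, measure_biUnion_finset hdisj fun I _ => hle _ (hA I)]
        _ ≤ 1 * ENNReal.ofReal (4 * δ) := by gcongr; exact prob_le_one
        _ = _ := one_mul _
    have hsplit : ENNReal.ofReal ((k + 1 : ℕ) * (4 * δ)) =
        ENNReal.ofReal (k * (4 * δ)) + ENNReal.ofReal (4 * δ) := by
      rw [← ENNReal.ofReal_add (by positivity) (by positivity)]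
      congr 1
      push_cast
      ring
    rw [hsplit]
    refine (measure_mono ?_).trans ((measure_union_le _ _).trans (add_le_add ih' hnew))
    intro ω hω
    by_cases hgood : RunGood D₀ D₁ δ θ T k (lineResponses u ω)
    · right
      obtain ⟨I, q, hrun, h0, h1, hlen, hI, hq⟩ := hgood
      refine Set.mem_iUnion₂.2 ⟨I, mem_intervals_of_runEpochs hrun, ⟨q, hrun⟩,
        ⟨h0, h1, hlen, hI⟩, fun he => hω ?_⟩
      exact runGood_succ hrun h0 h1 hlen hq he
    · exact Or.inl hgood

end

/-! ### The algorithm for boundary fragments -/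

theorem latticePoint_mem_cube {m M : ℕ} (a : Fin m → Fin M) : latticePoint M a ∈ cube m := by
  refine ⟨fun i => ?_, fun i => ?_⟩
  · simp only [latticePoint, Pi.zero_apply]
    positivity
  · have h := (a i).isLt
    have hM : (0 : ℝ) < M := by
      have : 0 < M := by omega
      exact_mod_cast this
    simp only [latticePoint, Pi.one_apply]
    rw [div_le_one hM]
    exact_mod_cast h.le

theorem thresholdAlg_of_runGood {D₀ D₁ ε δ θ : ℝ} {T N : ℕ} {resp : ℕ → ℕ → ℝ → Response}
    (hN : epochLog ε = N) (h : RunGood D₀ D₁ (δ / (4 * N)) θ T N resp) :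
    ∃ r, thresholdAlg D₀ D₁ ε δ resp = some r ∧ r.2 ≤ 3 * T * N := by
  obtain ⟨I, q, hrun, -, -, -, -, hq⟩ := h
  refine ⟨((I.1 + I.2) / 2, q), ?_, hq⟩
  rw [thresholdAlg, hN, Nat.floor_natCast, hrun]
  rfl

theorem boundaryAlg_of_thresholdAlg {m : ℕ} {D₀ D₁ ε δ : ℝ} {γ M B : ℕ} {ω : ResponseTable m}
    (h : ∀ a : Fin m → Fin M, ∃ r, thresholdAlg D₀ D₁ ε (δ / (M : ℝ) ^ m)
      (lineResponses (latticePoint M a) ω) = some r ∧ r.2 ≤ B) :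
    ∃ r, boundaryAlg D₀ D₁ ε δ γ M ω = some r ∧ r.2 ≤ M ^ m * B := by
  choose r hr hB using h
  have hrun : ∀ a, thresholdAlg D₀ D₁ ε (δ / (M : ℝ) ^ m)
      (fun k i t => ω (k, i, (latticePoint M a, t))) = some (r a) := hr
  have hsome : boundaryAlg D₀ D₁ ε δ γ M ω =
      some (interpolate γ M fun a => (r a).1, ∑ a, (r a).2) := by
    unfold boundaryAlg
    dsimp only
    rw [if_pos fun a => by rw [hrun]; rfl]
    simp only [hrun, Option.getD_some]
  refine ⟨_, hsome, ?_⟩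
  calc ∑ a, (r a).2 ≤ ∑ _a : Fin m → Fin M, B := Finset.sum_le_sum fun a _ => hB a
    _ = M ^ m * B := by simp

/-- On a line, N epochs at failure probability 4·δ/(M^m·4N) cost at most δ/M^m, and the M^m lines
together at most δ. Independence between lines is not needed. -/
theorem ofReal_le_responseLaw_boundaryAlg {m : ℕ} {P : Labeler m} {g : (Fin m → ℝ) → ℝ}
    {D₀ D₁ ε δ : ℝ} {γ M N T : ℕ} (hM : 0 < M) (hN : epochLog ε = N) (hδ : 0 ≤ δ)
    (hg : Set.MapsTo g (cube m) (Set.Icc 0 1))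
    (hepoch : ∀ u ∈ cube m, ∀ k < N, ∀ I : ℝ × ℝ, 0 ≤ I.1 → I.2 ≤ 1 →
      I.2 - I.1 = (3 / 4) ^ k → g u ∈ Set.Icc I.1 I.2 →
      epochLaw (fun t => P (u, t)) {z | ¬ EpochGood D₀ D₁ (δ / (M : ℝ) ^ m / (4 * N)) (g u) T I
        fun i t => z (i, t)} ≤ ENNReal.ofReal (4 * (δ / (M : ℝ) ^ m / (4 * N)))) :
    ENNReal.ofReal (1 - δ) ≤ responseLaw P {ω | ∃ r, boundaryAlg D₀ D₁ ε δ γ M ω = some r ∧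
      r.2 ≤ M ^ m * (3 * T * N)} := by
  have hMr : (0 : ℝ) < M := by exact_mod_cast hM
  have hline : ∀ a : Fin m → Fin M, responseLaw P {ω | ¬ RunGood D₀ D₁
      (δ / (M : ℝ) ^ m / (4 * N)) (g (latticePoint M a)) T N
        (lineResponses (latticePoint M a) ω)} ≤ ENNReal.ofReal (δ / (M : ℝ) ^ m) := by
    intro a
    have hu := latticePoint_mem_cube a
    refine (responseLaw_not_runGood_le (by positivity) (hg hu) (hepoch _ hu) N le_rfl).trans
      (ENNReal.ofReal_le_ofReal ?_)
    rcases Nat.eq_zero_or_pos N with rfl | hN0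
    · simp only [Nat.cast_zero, zero_mul]
      positivity
    · have : (0 : ℝ) < N := by exact_mod_cast hN0
      apply le_of_eq
      field_simp
  have hbad : responseLaw P (⋃ a : Fin m → Fin M, {ω | ¬ RunGood D₀ D₁
      (δ / (M : ℝ) ^ m / (4 * N)) (g (latticePoint M a)) T N
        (lineResponses (latticePoint M a) ω)}) ≤ ENNReal.ofReal δ := by
    refine (measure_iUnion_fintype_le _ _).trans ((Finset.sum_le_sum fun a _ => hline a).trans ?_)
    rw [Finset.sum_const, nsmul_eq_mul, ← ENNReal.ofReal_natCast, ← ENNReal.ofReal_mul (by positivity)]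
    apply ENNReal.ofReal_le_ofReal
    apply le_of_eq
    simp only [Finset.card_univ, Fintype.card_fun, Fintype.card_fin, Nat.cast_pow]
    field_simp
  refine ofReal_one_sub_le_of_compl hδ hbad fun ω hω => ?_
  by_contra hcon
  simp only [Set.mem_iUnion, Set.mem_ofPred_eq, not_exists, not_not] at hcon
  exact hω (boundaryAlg_of_thresholdAlg fun a => thresholdAlg_of_runGood hN (hcon a))

/-! ### The number of queries -/

theorem epochLog_eq_iff {ε : ℝ} {N : ℕ} (hε : 0 < ε) (hN : epochLog ε = N) :
    2 * ε = (3 / 4) ^ N := by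
  have h := Real.rpow_logb (b := 4 / 3) (x := 1 / (2 * ε)) (by norm_num) (by norm_num)
    (by positivity)
  rw [epochLog] at hN
  rw [hN, Real.rpow_natCast] at h
  have h2 : ((3 : ℝ) / 4) ^ N = 1 / (4 / 3) ^ N := by
    rw [← one_div_pow]; norm_num
  rw [h2, h, one_div_one_div]

theorem epochs_le {ε : ℝ} {N : ℕ} (hε : 0 < ε) (hN : epochLog ε = N) :
    (N : ℝ) ≤ 4 * Real.log (1 / ε) := by
  have h := congrArg Real.log (epochLog_eq_iff hε hN)
  rw [Real.log_mul (by norm_num) hε.ne', Real.log_pow] at h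
  have h34 : Real.log (3 / 4) ≤ -(1 / 4) := by
    have := Real.log_le_sub_one_of_pos (x := 3 / 4) (by norm_num)
    linarith
  rw [one_div, Real.log_inv]
  have h2 := Real.log_two_gt_d9
  nlinarith [(Nat.cast_nonneg N : (0 : ℝ) ≤ N)]

/-- Resolves a circularity: the number k of answers is proportional to B, and k also occurs inside
its own threshold through lnln(4k). -/
theorem exists_ge_add_mul_log (a : ℝ) {c : ℝ} (hc : 0 < c) :
    ∃ B, 1 ≤ B ∧ a + c * Real.log B ≤ B := by
  set B := max 1 (2 * (a + c * Real.log (2 * c))) with hB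
  have hB1 : 1 ≤ B := le_max_left _ _
  refine ⟨B, hB1, ?_⟩
  have h1 := log_le_div_add_log (x := B) (c := 2 * c) (by linarith) (by linarith)
  have h2 : 2 * (a + c * Real.log (2 * c)) ≤ B := le_max_right _ _
  have h3 : c * Real.log B ≤ c * (B / (2 * c) + Real.log (2 * c)) := by gcongr
  have h4 : c * (B / (2 * c)) = B / 2 := by field_simp
  rw [mul_add, h4] at h3
  linarith

/-- The number of answers that suffices for `CheckSignificant` at bias `b`. -/
theorem two_mul_thresholdP_le {D₀ δ b L : ℝ} {k : ℕ} (hD : 0 < D₀) (hb : 0 < b)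
    (hL : Real.log (1 / δ) = L)
    (h1 : 4 * D₀ * (1 + L) * (1 / b) ≤ k)
    (h2 : 64 * D₀ ^ 2 * (lnlnPlus (4 * k) + L) * (1 / b ^ 2) ≤ k) :
    2 * thresholdP D₀ k δ ≤ b * k := by
  rw [thresholdP, hL]
  have hk : (0 : ℝ) ≤ k := Nat.cast_nonneg k
  have hl := one_le_lnlnPlus (4 * k)
  have e1 : 4 * D₀ * (1 + L) ≤ b * k := by
    rw [mul_one_div, div_le_iff₀ hb] at h1
    linarith
  have e2 : 64 * D₀ ^ 2 * (lnlnPlus (4 * k) + L) ≤ b ^ 2 * k := by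
    rw [mul_one_div, div_le_iff₀ (by positivity)] at h2
    linarith
  have e3 : 4 * D₀ * √(4 * k * (lnlnPlus (4 * k) + L)) ≤ b * k := by
    rw [← le_div_iff₀' (by positivity), Real.sqrt_le_left (by positivity), div_pow,
      le_div_iff₀ (by positivity)]
    nlinarith
  linarith

/-- The number of answers and the number of rounds of an epoch. -/
theorem exists_rounds {D₀ C β A : ℝ} (hD : 0 < D₀) (hC : 0 < C) (hβ : 0 ≤ β) (hA : 0 < A) :
    ∃ K : ℝ, 0 < K ∧ ∀ (ε δ H φ : ℝ), 0 < ε → ε ≤ 1 / 2 → 0 < δ → δ < 1 → 0 < φ → φ ≤ 1 →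
      1 + Real.log (1 / ε) ≤ H → 1 + Real.log (1 / δ) ≤ A * H →
      ∃ k T : ℕ, 1 ≤ k ∧ 2 * thresholdP D₀ k δ ≤ C * (ε / 2) ^ β * k ∧
        2 * (k + Real.log (1 / δ)) ≤ φ * T ∧ (T : ℝ) ≤ K * (ε ^ (-2 * β) * H / φ) := by
  -- For the bias b = C(ε/2)^β one has 1/b² = (4^β/C²)·ε^(-2β). The summand 1 makes G·ε^(-2β)
  -- dominate 1/b as well.
  set G := 1 + 4 ^ β / C ^ 2 with hG
  have hG1 : 1 ≤ G := by
    have : (0 : ℝ) ≤ 4 ^ β / C ^ 2 := by positivity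
    linarith
  obtain ⟨B, hB1, hB⟩ := exists_ge_add_mul_log
    (4 * D₀ * A * G + 64 * D₀ ^ 2 * G * (8 + 2 * β + A)) (c := 64 * D₀ ^ 2 * G) (by positivity)
  have hlogB : 0 ≤ Real.log B := Real.log_nonneg hB1
  have hBa : 4 * D₀ * A * G ≤ B := by
    have : 0 ≤ 64 * D₀ ^ 2 * G * (8 + 2 * β + A) := by positivity
    have : 0 ≤ 64 * D₀ ^ 2 * G * Real.log B := by positivity
    linarith
  have hBb : 64 * D₀ ^ 2 * G * (8 + 2 * β + A + Real.log B) ≤ B := by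
    have : 0 ≤ 4 * D₀ * A * G := by positivity
    linarith
  refine ⟨4 * B + 2 * A + 1, by positivity, ?_⟩
  intro ε δ H φ hε hε2 hδ hδ1 hφ hφ1 hH hL
  set L := Real.log (1 / δ) with hLdef
  have hL0 : 0 ≤ L := log_one_div_nonneg hδ hδ1.le
  have hlε : 0 ≤ Real.log (1 / ε) := log_one_div_nonneg hε (by linarith)
  have hH1 : 1 ≤ H := by linarith
  set Q := ε ^ (-2 * β) with hQ
  have hlogQ : Real.log Q = 2 * β * Real.log (1 / ε) := by
    rw [hQ, Real.log_rpow hε, one_div, Real.log_inv]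
    ring
  have hQ0 : 0 < Q := Real.rpow_pos_of_pos hε _
  have hQ1 : 1 ≤ Q := Real.one_le_rpow_of_pos_of_le_one_of_nonpos hε (by linarith) (by linarith)
  set b := C * (ε / 2) ^ β with hb
  have hb0 : 0 < b := by positivity
  have hbQ : 1 / b ^ 2 = 4 ^ β / C ^ 2 * Q := by
    rw [hb, hQ, mul_pow, Real.div_rpow hε.le (by norm_num), div_pow, ← Real.rpow_mul_natCast hε.le,
      ← Real.rpow_mul_natCast (by norm_num : (0 : ℝ) ≤ 2)]
    have h4 : (2 : ℝ) ^ (β * (2 : ℕ)) = 4 ^ β := by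
      rw [mul_comm, Real.rpow_mul (by norm_num)]
      norm_num
    have h5 : ε ^ (-2 * β) = (ε ^ (β * (2 : ℕ)))⁻¹ := by
      rw [← Real.rpow_neg hε.le]
      congr 1
      push_cast
      ring
    rw [h4, h5]
    have : ε ^ (β * (2 : ℕ)) ≠ 0 := (Real.rpow_pos_of_pos hε _).ne'
    field_simp
  have hb2 : 1 / b ^ 2 ≤ G * Q := by
    rw [hbQ]
    gcongr
    linarith
  have hb1 : 1 / b ≤ G * Q := by
    have : 1 / b ≤ 1 + 1 / b ^ 2 := by
      have h : 1 / b ^ 2 = (1 / b) ^ 2 := by rw [div_pow, one_pow]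
      rw [h]
      nlinarith [sq_nonneg (1 / b - 1), sq_nonneg (1 / b)]
    rw [hbQ] at this
    rw [hG]
    linarith
  set x := B * Q * H with hx
  have hx1 : 1 ≤ x := by
    have : 1 ≤ B * Q := one_le_mul_of_one_le_of_one_le hB1 hQ1
    exact one_le_mul_of_one_le_of_one_le this hH1
  set k := ⌈x⌉₊ with hk
  have hkx : x ≤ k := Nat.le_ceil x
  have hkx2 : (k : ℝ) ≤ 2 * x := by
    have := Nat.ceil_lt_add_one (by linarith : 0 ≤ x)
    linarith
  have hk1 : (1 : ℝ) ≤ k := hx1.trans hkx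
  -- The iterated logarithm is bounded crudely by a logarithm, and ln H by H; the loss is hidden in
  -- H.
  have hlnln : lnlnPlus (4 * k) + L ≤ (8 + 2 * β + A + Real.log B) * H := by
    have e1 := lnlnPlus_le_log (4 * k)
    have e2 : max (4 * (k : ℝ)) (Real.exp (Real.exp 1)) ≤ 8 * x * Real.exp (Real.exp 1) := by
      have : 1 ≤ Real.exp (Real.exp 1) := Real.one_le_exp (Real.exp_pos 1).le
      refine max_le ?_ ?_
      · calc 4 * (k : ℝ) ≤ 8 * x := by linarith
          _ ≤ _ := le_mul_of_one_le_right (by linarith) this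
      · exact le_mul_of_one_le_left (by linarith) (by linarith)
    have e3 := Real.log_le_log (lt_max_of_lt_right (Real.exp_pos _)) e2
    rw [Real.log_mul (by positivity) (Real.exp_pos _).ne', Real.log_exp,
      Real.log_mul (by norm_num) (by positivity), hx, Real.log_mul (by positivity) (by positivity),
      Real.log_mul (by positivity) (by positivity), hlogQ] at e3
    have e8 : Real.log 8 ≤ 3 := by
      have : (8 : ℝ) = 2 ^ 3 := by norm_num
      rw [this, Real.log_pow]
      have := Real.log_two_lt_d9
      push_cast
      linarith
    have eH : Real.log H ≤ H := (Real.log_le_sub_one_of_pos (by linarith)).trans (by linarith)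
    have ee : Real.exp 1 ≤ 3 := by linarith [Real.exp_one_lt_d9]
    have eβ : 2 * β * Real.log (1 / ε) ≤ 2 * β * H := by gcongr; linarith
    have eB : Real.log B ≤ Real.log B * H := le_mul_of_one_le_right hlogB hH1
    linarith
  have hthr : 2 * thresholdP D₀ k δ ≤ b * k := by
    refine two_mul_thresholdP_le hD hb0 hLdef.symm ?_ ?_
    · calc 4 * D₀ * (1 + L) * (1 / b) ≤ 4 * D₀ * (A * H) * (G * Q) := by gcongr
        _ = (4 * D₀ * A * G) * (Q * H) := by ring
        _ ≤ B * (Q * H) := by gcongr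
        _ ≤ k := by rw [← mul_assoc]; exact hkx
    · have hl := one_le_lnlnPlus (4 * k)
      calc 64 * D₀ ^ 2 * (lnlnPlus (4 * k) + L) * (1 / b ^ 2)
          ≤ 64 * D₀ ^ 2 * ((8 + 2 * β + A + Real.log B) * H) * (G * Q) := by gcongr
        _ = (64 * D₀ ^ 2 * G * (8 + 2 * β + A + Real.log B)) * (Q * H) := by ring
        _ ≤ B * (Q * H) := by gcongr
        _ ≤ k := by rw [← mul_assoc]; exact hkx
  refine ⟨k, ⌈2 * (k + L) / φ⌉₊, by exact_mod_cast hk1, hthr, ?_, ?_⟩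
  · have := Nat.le_ceil (2 * (k + L) / φ)
    rw [div_le_iff₀ hφ] at this
    linarith
  · have h1 := Nat.ceil_lt_add_one (show 0 ≤ 2 * (k + L) / φ by positivity)
    have h2 : (1 : ℝ) ≤ 1 / φ := by rw [le_div_iff₀ hφ]; linarith
    have hQH : H ≤ Q * H := le_mul_of_one_le_left (by linarith) hQ1
    calc (⌈2 * (k + L) / φ⌉₊ : ℝ) ≤ 2 * (k + L) / φ + 1 / φ := by linarith
      _ = (2 * (k + L) + 1) / φ := by ring
      _ ≤ ((4 * B + 2 * A + 1) * (Q * H)) / φ := by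
        gcongr
        have e1 : (k : ℝ) ≤ 2 * (B * (Q * H)) :=
          hkx2.trans_eq (by rw [hx, mul_assoc B])
        have e2 : A * H ≤ A * (Q * H) := by gcongr
        linarith
      _ = _ := by ring

/-- The confidence level of the tests. -/
theorem log_level_le {c₂ ε δ : ℝ} {d γ M N : ℕ} (hd : 2 ≤ d) (hγ : 1 ≤ γ)
    (hε : 0 < ε) (hε2 : ε ≤ 1 / 2) (hN : epochLog ε = N) (hN1 : 1 ≤ N) (hδ : 0 < δ) (hδ1 : δ < 1)
    (hM : 0 < M) (hMc : (M : ℝ) ≤ c₂ * ε ^ (-1 / (γ : ℝ))) (hc₂ : 0 < c₂) :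
    1 + Real.log (1 / (δ / (M : ℝ) ^ (d - 1) / (4 * N))) ≤
      (10 + |Real.log c₂|) * (d * (1 + Real.log (1 / ε)) * (1 + Real.log (1 / δ))) := by
  have hMr : (0 : ℝ) < M := by exact_mod_cast hM
  have hNr : (1 : ℝ) ≤ N := by exact_mod_cast hN1
  have hlδ : 0 ≤ Real.log (1 / δ) := log_one_div_nonneg hδ hδ1.le
  have hlε : 0 ≤ Real.log (1 / ε) := log_one_div_nonneg hε (by linarith)
  have heq : 1 / (δ / (M : ℝ) ^ (d - 1) / (4 * N)) = 4 * N * (M : ℝ) ^ (d - 1) * (1 / δ) := by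
    field_simp
  rw [heq, Real.log_mul (by positivity) (by positivity), Real.log_mul (by positivity)
    (by positivity), Real.log_mul (by norm_num) (by positivity), Real.log_pow]
  have h4 : Real.log 4 ≤ 2 := by
    have : (4 : ℝ) = 2 ^ 2 := by norm_num
    rw [this, Real.log_pow]
    have := Real.log_two_lt_d9
    push_cast
    linarith
  have hlN : Real.log N ≤ 4 * Real.log (1 / ε) :=
    (Real.log_le_sub_one_of_pos (by linarith)).trans (by linarith [epochs_le hε hN])
  -- Since γ ≥ 1, the exponent 1/γ can be dropped, and the constant depends on c₂ only.
  have hlM : Real.log M ≤ |Real.log c₂| + Real.log (1 / ε) := by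
    have h := Real.log_le_log hMr hMc
    rw [Real.log_mul hc₂.ne' (Real.rpow_pos_of_pos hε _).ne', Real.log_rpow hε] at h
    have h2 : -1 / (γ : ℝ) * Real.log ε = 1 / (γ : ℝ) * Real.log (1 / ε) := by
      rw [one_div ε, Real.log_inv]; ring
    rw [h2] at h
    have h3 : 1 / (γ : ℝ) * Real.log (1 / ε) ≤ 1 * Real.log (1 / ε) := by
      gcongr
      rw [div_le_one (by positivity)]
      exact_mod_cast hγ
    linarith [le_abs_self (Real.log c₂)]
  have hd1 : ((d - 1 : ℕ) : ℝ) ≤ d := by exact_mod_cast Nat.sub_le d 1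
  have hd2 : (2 : ℝ) ≤ d := by exact_mod_cast hd
  set c := |Real.log c₂| with hc
  have hc0 : 0 ≤ c := abs_nonneg _
  set e := Real.log (1 / ε)
  set q := Real.log (1 / δ)
  -- The union over M^(d-1) lines contributes (d-1)·ln M; this is the source of the factor d in the
  -- query bound.
  have hdm : ((d - 1 : ℕ) : ℝ) * Real.log M ≤ d * (c + e) := by
    calc ((d - 1 : ℕ) : ℝ) * Real.log M ≤ ((d - 1 : ℕ) : ℝ) * (c + e) := by gcongr
      _ ≤ _ := by gcongr
  have hde : 0 ≤ d * e := by positivity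
  have hdq : 0 ≤ d * q := by positivity
  have e1 : 4 * e ≤ 4 * (d * e) := by nlinarith
  have e2 : q ≤ d * q := by nlinarith
  have e3 : 0 ≤ c * (d * e) + c * (d * q) + c * (d * (e * q)) + 10 * (d * (e * q)) := by
    positivity
  have e4 : (10 + c) * (d * (1 + e) * (1 + q)) = 10 * d + 10 * (d * e) + 10 * (d * q) + c * d +
      (c * (d * e) + c * (d * q) + c * (d * (e * q)) + 10 * (d * (e * q))) := by ring
  rw [e4]
  linarith [mul_add (d : ℝ) c e, mul_comm c (d : ℝ)]

end AbstentionLearning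

end

/-! ### The main theorem -/

theorem mainTheorem8 :
    (∃ D₀ : ℝ, UniformBernstein D₀) ∧ (∃ D₁ : ℝ, UniformEmpiricalBernstein D₁) ∧
    ∃ p : ℕ, ∀ D₀ D₁ : ℝ, UniformBernstein D₀ → UniformEmpiricalBernstein D₁ →
      ∀ C β c₂ : ℝ, 0 < C → 0 ≤ β → 0 < c₂ →
      ∃ K : ℝ, 0 < K ∧
        ∀ (d γ M N : ℕ) (c₁ ε δ : ℝ), 2 ≤ d → 1 ≤ γ →
          0 < c₁ → 0 < ε → epochLog ε = N → 0 < δ → δ < 1 →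
          c₁ * ε ^ (-1 / (γ : ℝ)) ≤ M → (M : ℝ) ≤ c₂ * ε ^ (-1 / (γ : ℝ)) → γ ∣ M →
        ∀ f : ℝ → ℝ, MonotoneOn f (Set.Icc 0 1) → Set.MapsTo f (Set.Icc 0 1) (Set.Icc 0 1) →
          0 < f (ε / 2) →
        ∀ g : (Fin (d - 1) → ℝ) → ℝ, Set.MapsTo g (cube (d - 1)) (Set.Icc 0 1) →
        ∀ P : Labeler (d - 1), MonotoneLabeler P g → BoundedLabeler P g C β f →
          ENNReal.ofReal (1 - δ) ≤
            responseLaw P {ω | ∃ r, boundaryAlg D₀ D₁ ε δ γ M ω = some r ∧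
              (r.2 : ℝ) ≤ K * c₂ ^ (d - 1) *
                (d / f (ε / 2) * ε ^ (-2 * β - ((d : ℝ) - 1) / γ)) *
                ((1 + Real.log (1 / ε)) * (1 + Real.log (1 / δ)) * (1 + Real.log d)) ^ p} := by
  -- The exponent is 2: one factor 1 + ln(1/ε) comes from the number of epochs, another from the
  -- level of the tests.
  refine ⟨⟨64, uniformBernstein_of_const⟩, exists_uniformEmpiricalBernstein, 2, ?_⟩
  intro D₀ D₁ hD₀ hD₁ C β c₂ hC hβ hc₂
  obtain ⟨K, hK, hrounds⟩ := exists_rounds (A := 10 + |Real.log c₂|) hD₀.pos hC hβ (by positivity)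
  -- 12 = 3·4: three queries per round, and N ≤ 4(1 + ln(1/ε)) epochs.
  refine ⟨12 * K, by positivity, ?_⟩
  intro d γ M N c₁ ε δ hd hγ hc₁ hε hN hδ hδ1 hMl hMu _ f hf hfm hf0 g hg P hP hB
  have hεN := epochLog_eq_iff hε hN
  have hε2 : ε ≤ 1 / 2 := by
    have : ((3 : ℝ) / 4) ^ N ≤ 1 := pow_le_one₀ (by norm_num) (by norm_num)
    linarith
  have hMr : (0 : ℝ) < M := (mul_pos hc₁ (Real.rpow_pos_of_pos hε _)).trans_le hMl
  have hM : 0 < M := by exact_mod_cast hMr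
  have hf1 : f (ε / 2) ≤ 1 := (hfm ⟨by linarith, by linarith⟩).2
  have hlδ : 0 ≤ Real.log (1 / δ) := log_one_div_nonneg hδ hδ1.le
  have hlε : 0 ≤ Real.log (1 / ε) := log_one_div_nonneg hε (by linarith)
  have hd2 : (2 : ℝ) ≤ d := by exact_mod_cast hd
  have hld : 0 ≤ Real.log d := Real.log_nonneg (by linarith)
  set H := d * (1 + Real.log (1 / ε)) * (1 + Real.log (1 / δ)) with hH
  have hH1 : 1 + Real.log (1 / ε) ≤ H := by
    calc 1 + Real.log (1 / ε) = 1 * (1 + Real.log (1 / ε)) * 1 := by ring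
      _ ≤ d * (1 + Real.log (1 / ε)) * (1 + Real.log (1 / δ)) := by gcongr <;> linarith
  have hT : ∃ T : ℕ, (T : ℝ) ≤ K * (ε ^ (-2 * β) * H / f (ε / 2)) ∧ (1 ≤ N → ∃ k : ℕ, 1 ≤ k ∧
      2 * thresholdP D₀ k (δ / (M : ℝ) ^ (d - 1) / (4 * N)) ≤ C * (ε / 2) ^ β * k ∧
      2 * (k + Real.log (1 / (δ / (M : ℝ) ^ (d - 1) / (4 * N)))) ≤ f (ε / 2) * T ∧
      0 < δ / (M : ℝ) ^ (d - 1) / (4 * N) ∧ δ / (M : ℝ) ^ (d - 1) / (4 * N) < 1) := by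
    -- For N = 0 there are no epochs and the level would divide by zero; T = 0 serves.
    rcases Nat.eq_zero_or_pos N with hN0 | hN1
    · refine ⟨0, ?_, fun h => absurd h (by omega)⟩
      have : 0 ≤ H := by linarith
      rw [Nat.cast_zero]
      positivity
    · have hNr : (1 : ℝ) ≤ N := by exact_mod_cast hN1
      have hM1 : (1 : ℝ) ≤ (M : ℝ) ^ (d - 1) := one_le_pow₀ (by exact_mod_cast hM)
      have hδ' : 0 < δ / (M : ℝ) ^ (d - 1) / (4 * N) := by positivity
      have hδ1' : δ / (M : ℝ) ^ (d - 1) / (4 * N) < 1 := by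
        rw [div_div, div_lt_one (by positivity)]
        nlinarith
      obtain ⟨k, T, h1, h2, h3, h4⟩ := hrounds ε _ H (f (ε / 2)) hε hε2 hδ' hδ1' hf0 hf1 hH1
        (log_level_le hd hγ hε hε2 hN hN1 hδ hδ1 hM hMu hc₂)
      exact ⟨T, h4, fun _ => ⟨k, h1, h2, h3, hδ', hδ1'⟩⟩
  obtain ⟨T, hTle, hTk⟩ := hT
  refine (ofReal_le_responseLaw_boundaryAlg (γ := γ) (T := T) hM hN hδ.le hg
    (D₀ := D₀) (D₁ := D₁) ?_).trans (measure_mono ?_)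
  · intro u hu j hj I hI0 hI1 hlen hgI
    obtain ⟨k, h1, h2, h3, h4, h5⟩ := hTk (by omega)
    refine epochLaw_not_epochGood_le hD₀ hD₁ hP hB hC hβ hf hu h4 h5 hI0 hI1 hgI
      (by linarith : 0 < ε / 2) ?_ hf0 h1 h2 h3
    -- Since (3/4)^N = 2ε, a quarter of every interval that occurs is at least ε/2.
    have : ((3 : ℝ) / 4) ^ N ≤ (3 / 4) ^ j :=
      pow_le_pow_of_le_one (by norm_num) (by norm_num) hj.le
    linarith
  · rintro ω ⟨r, hr, hrq⟩
    refine ⟨r, hr, ?_⟩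
    have hq : (r.2 : ℝ) ≤ (M : ℝ) ^ (d - 1) * (3 * T * N) := by exact_mod_cast hrq
    refine hq.trans ?_
    have hMpow : (M : ℝ) ^ (d - 1) ≤ c₂ ^ (d - 1) * ε ^ (-((d : ℝ) - 1) / γ) := by
      calc (M : ℝ) ^ (d - 1) ≤ (c₂ * ε ^ (-1 / (γ : ℝ))) ^ (d - 1) := by gcongr
        _ = _ := by
          rw [mul_pow, ← Real.rpow_mul_natCast hε.le, Nat.cast_sub (by omega)]
          congr 2
          push_cast
          ring
    have hexp : ε ^ (-2 * β - ((d : ℝ) - 1) / γ) = ε ^ (-((d : ℝ) - 1) / γ) * ε ^ (-2 * β) := by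
      rw [← Real.rpow_add hε]
      congr 1
      ring
    have hNle : (N : ℝ) ≤ 4 * (1 + Real.log (1 / ε)) := by linarith [epochs_le hε hN]
    have hE := Real.rpow_pos_of_pos hε (-((d : ℝ) - 1) / γ)
    have hQ := Real.rpow_pos_of_pos hε (-2 * β)
    have hlogs : (1 + Real.log (1 / ε)) ^ 2 * (1 + Real.log (1 / δ)) ≤
        ((1 + Real.log (1 / ε)) * (1 + Real.log (1 / δ)) * (1 + Real.log d)) ^ 2 := by
      have e1 : 1 ≤ (1 + Real.log (1 / δ)) * (1 + Real.log d) ^ 2 :=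
        one_le_mul_of_one_le_of_one_le (by linarith) (one_le_pow₀ (by linarith))
      calc (1 + Real.log (1 / ε)) ^ 2 * (1 + Real.log (1 / δ))
          ≤ (1 + Real.log (1 / ε)) ^ 2 * (1 + Real.log (1 / δ)) *
            ((1 + Real.log (1 / δ)) * (1 + Real.log d) ^ 2) :=
            le_mul_of_one_le_right (by positivity) e1
        _ = _ := by ring
    calc (M : ℝ) ^ (d - 1) * (3 * T * N)
        ≤ (c₂ ^ (d - 1) * ε ^ (-((d : ℝ) - 1) / γ)) *
          (3 * (K * (ε ^ (-2 * β) * H / f (ε / 2))) * (4 * (1 + Real.log (1 / ε)))) := by gcongr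
      _ = 12 * K * c₂ ^ (d - 1) * (d / f (ε / 2) * ε ^ (-2 * β - ((d : ℝ) - 1) / γ)) *
          ((1 + Real.log (1 / ε)) ^ 2 * (1 + Real.log (1 / δ))) := by
          rw [hexp, hH]; ring
      _ ≤ _ := by gcongr
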